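/- Let $n$ be even and $m$ odd, and let $\Gamma$ be a finite Abelian group of order $mn$. Suppose that $\Gamma$ has a subgroup $H$ of order $m$ such that the quotient $K=\Gamma/H$, which has order $n$, satisfies the following condition: $n$ is odd, or $n$ is even and $K$ has a subgroup isomorphic to $\mathbb{Z}_2\oplus\mathbb{Z}_{2s}$ for some integer $s\ge 2$. (As $n$ is even here, this means that $\Gamma/H$ has a subgroup isomorphic to $\mathbb{Z}_2\oplus\mathbb{Z}_{2s}$ with $s\ge 2$.) Then the Dutch windmill graph $D_n^m$, which consists of $m$ copies of the cycle $C_n$ sharing exactly one common vertex, is $\Gamma$-harmonious; that is, there is an injection $f:V(D_n^m)\to\Gamma$ such that $xy\mapsto f(x)+f(y)$ is a bijection from $E(D_n^m)$ to $\Gamma$. -/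

import Mathlib

/-- The sum labelling `xy ↦ f x + f y` of unordered pairs induced by a vertex labelling `f`. -/
def inducedEdgeLabel {V Γ : Type*} [AddCommGroup Γ] (f : V → Γ) : Sym2 V → Γ :=
  Sym2.lift ⟨fun x y => f x + f y, fun x y => add_comm (f x) (f y)⟩

/-- `G` is `Γ`-harmonious: some injective vertex labelling with values in `Γ` induces, by sums, a
bijection from the edges of `G` onto `Γ` (so `Γ` has as many elements as `G` has edges). -/
def IsHarmonious {V : Type*} (G : SimpleGraph V) (Γ : Type*) [AddCommGroup Γ] : Prop :=
  ∃ f : V → Γ, Function.Injective f ∧ Set.BijOn (inducedEdgeLabel f) G.edgeSet Set.univ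

/-- Vertices of the Dutch windmill with `m` blades of length `n`: the central vertex `none`, and
the vertices `some (j, i)`, the `i`-th vertex (`1 ≤ i ≤ n - 1`) of the `j`-th blade. -/
abbrev WindmillVertex (n m : ℕ) : Type :=
  Option (Fin m × {i : Fin n // (i : ℕ) ≠ 0})

/-- The `j`-th copy of the vertex set `{0, …, n - 1}` of the cycle, its vertex `0` being the
central vertex. -/
def windmillBlade (n m : ℕ) (j : Fin m) (i : Fin n) : WindmillVertex n m :=
  if h : (i : ℕ) ≠ 0 then some (j, ⟨i, h⟩) else none

/-- The Dutch windmill graph `D_n^m` (for `n ≥ 3`): `m` copies of the cycle `C_n` which share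
exactly the central vertex. -/
def dutchWindmill (n m : ℕ) : SimpleGraph (WindmillVertex n m) :=
  ⨆ j : Fin m, (SimpleGraph.cycleGraph n).map (windmillBlade n m j)

/-- The group condition of the characterization of harmonious labellings of the cycle `C_n`:
`K` has order `n`, and either `n` is odd, or `n` is even and `K` has a subgroup isomorphic to
`Z_2 ⊕ Z_{2s}` for some `s ≥ 2`. -/
def CycleCondition (n : ℕ) (K : Type*) [AddCommGroup K] : Prop :=
  Nat.card K = n ∧
    (Odd n ∨
      (Even n ∧ ∃ s : ℕ, 2 ≤ s ∧
        ∃ S : AddSubgroup K, Nonempty (S ≃+ ZMod 2 × ZMod (2 * s))))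

/-!
Let `H` have odd order `m`. If `θ` is a complete mapping of `Γ ⧸ H` with a single cycle, then lifts
of `x, θ x, θ (θ x), …` label one blade so that consecutive sums lie in distinct cosets of `H`;
translating all labels but the central one by the elements of `H` gives the other blades. An edge
sum moves by `h` or `h + h`, so since doubling is injective on `H` all edge sums are distinct.

Complete mappings lift along extensions: over a complete mapping `σ` of a quotient `Q`, complete
mappings of the kernel give complete mappings of the group. When the kernel is cyclic of odd order,
inserting a translation by a generator once on each cycle of `σ` preserves the number of cycles.
When `Q` is elementary Abelian of order four or eight, there is a `σ` that fixes `0` and permutes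
the nonzero elements cyclically. Using a mapping with one cycle over `0` and a mapping with two
cycles over the rest produces three cycles, and an exchange of four values that only permutes the
sums merges them into one. This is why mappings with one cycle and with two cycles are constructed
together. What remains are small groups, fields of prime order, and `ZMod 2 × ZMod (4 * q)`.
-/

/-- A complete mapping of the Abelian group `K`: a permutation `θ` for which `x ↦ x + θ x` is a
bijection too. Along a cycle of `θ` the sums of consecutive elements are then distinct. -/
def IsCompleteMapping {K : Type*} [AddCommGroup K] (θ : Equiv.Perm K) : Prop :=
  Function.Bijective fun x => x + θ x

/-- `K` has complete mappings with exactly one cycle and with exactly two cycles. A cyclic complete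
mapping is what a harmonious labelling needs; the second mapping makes the property pass from the
kernel of a homomorphism onto `ZMod 2 × ZMod 2` to the whole group. -/
structure IsSplittable (K : Type*) [AddCommGroup K] : Prop where
  exists_oneCycle : ∃ θ : Equiv.Perm K, IsCompleteMapping θ ∧ ∀ x y, θ.SameCycle x y
  exists_twoCycle : ∃ θ : Equiv.Perm K, IsCompleteMapping θ ∧
    ∃ u v, ¬ θ.SameCycle u v ∧ ∀ x, θ.SameCycle u x ∨ θ.SameCycle v x

section Cycles

open Equiv.Perm

theorem sameCycle_permCongr {α β : Type*} {f : Equiv.Perm α} (e : α ≃ β) {x y : α} :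
    (e.permCongr f).SameCycle (e x) (e y) ↔ f.SameCycle x y := by
  refine exists_congr fun n => ?_
  rw [← e.permCongrHom_coe, ← map_zpow, e.permCongrHom_coe, Equiv.permCongr_apply,
    e.symm_apply_apply, e.apply_eq_iff_eq]

theorem sameCycle_of_apply_eq {α : Type*} {f : Equiv.Perm α} {x y z : α} (h : f y = z)
    (hxy : f.SameCycle x y) : f.SameCycle x z :=
  h ▸ sameCycle_apply_right.2 hxy

variable {α : Type*} [Finite α] {f : Equiv.Perm α} {a b : α}

theorem mem_of_sameCycle {S : Set α} (hS : ∀ x ∈ S, f x ∈ S) (hab : f.SameCycle a b)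
    (ha : a ∈ S) : b ∈ S := by
  obtain ⟨n, rfl⟩ := hab.exists_nat_pow_eq
  rw [coe_pow]
  exact Set.MapsTo.iterate hS n ha

theorem apply_eq_of_sameCycle {β : Type*} {g : α → β} (hg : ∀ x, g (f x) = g x)
    (hab : f.SameCycle a b) : g b = g a :=
  mem_of_sameCycle (S := {x | g x = g a}) (fun x hx => (hg x).trans hx) hab rfl

theorem rel_of_sameCycle_of_ne {r : Setoid α} (h : ∀ x, f.SameCycle a x → x ≠ a → r x (f x))
    (hab : f.SameCycle a b) : r b a := by
  obtain ⟨n, hn⟩ := hab.symm.exists_nat_pow_eq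
  induction n generalizing b with
  | zero => exact hn ▸ r.refl b
  | succ n ih =>
    by_cases hb : b = a
    · exact hb ▸ r.refl b
    · exact r.trans (h b hab hb) (ih (sameCycle_apply_right.2 hab) (by rwa [pow_succ] at hn))

theorem sameCycle_mul_swap [DecidableEq α] (hab : ¬ f.SameCycle a b) :
    (f * Equiv.swap a b).SameCycle a b ∧
      ∀ x y, f.SameCycle x y → (f * Equiv.swap a b).SameCycle x y := by
  set g := f * Equiv.swap a b with hg
  let r := SameCycle.setoid g
  have step : ∀ x, r x (g x) := fun x => sameCycle_apply_right.2 (SameCycle.refl g x)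
  have step_of_ne : ∀ x, x ≠ a → x ≠ b → r x (f x) := fun x hxa hxb => by
    simpa only [hg, mul_apply, Equiv.swap_apply_of_ne_of_ne hxa hxb] using step x
  have step_left : r a (f a) := r.symm <|
    rel_of_sameCycle_of_ne (fun x hx hxa => step_of_ne x hxa fun h => hab (h ▸ hx))
      (sameCycle_apply_right.2 (SameCycle.refl f a))
  have step_right : r b (f b) := r.symm <|
    rel_of_sameCycle_of_ne (fun x hx hxb => step_of_ne x (fun h => hab (h ▸ hx.symm)) hxb)
      (sameCycle_apply_right.2 (SameCycle.refl f b))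
  constructor
  · have hga : r a (f b) := by simpa only [hg, mul_apply, Equiv.swap_apply_left] using step a
    exact r.trans hga (r.symm step_right)
  · intro x y hxy
    refine r.symm (rel_of_sameCycle_of_ne (fun z _ _ => ?_) hxy)
    rcases eq_or_ne z a with rfl | hza
    · exact step_left
    rcases eq_or_ne z b with rfl | hzb
    · exact step_right
    · exact step_of_ne z hza hzb

/-- Two swaps merge three cycles into one: the first merges the cycles of `b` and `c`, the second
merges the result with the cycle of `a`. -/
theorem sameCycle_mul_swap_mul_swap [DecidableEq α] {c d : α} (hab : ¬ f.SameCycle a b)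
    (hac : ¬ f.SameCycle a c) (had : ¬ f.SameCycle a d) (hbc : ¬ f.SameCycle b c)
    (hcover : ∀ x, f.SameCycle a x ∨ f.SameCycle b x ∨ f.SameCycle c x) (x y : α) :
    (f * Equiv.swap b c * Equiv.swap a d).SameCycle x y := by
  obtain ⟨hbc', hmono⟩ := sameCycle_mul_swap hbc
  set g := f * Equiv.swap b c with hg
  have hga : ∀ x, g.SameCycle a x → f.SameCycle a x := by
    refine fun x hx => mem_of_sameCycle (S := {x | f.SameCycle a x}) (fun z hz => ?_) hx
      (SameCycle.refl f a)
    have hzb : z ≠ b := fun h => hab (h ▸ hz)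
    have hzc : z ≠ c := fun h => hac (h ▸ hz)
    simpa only [Set.mem_ofPred_eq, hg, mul_apply, Equiv.swap_apply_of_ne_of_ne hzb hzc,
      sameCycle_apply_right] using hz
  have hgb : ∀ x, ¬ f.SameCycle a x → g.SameCycle b x := fun x hx => by
    rcases (hcover x).resolve_left hx with h | h
    · exact hmono _ _ h
    · exact hbc'.trans (hmono _ _ h)
  obtain ⟨had', hmono'⟩ := sameCycle_mul_swap fun h => had (hga d h)
  have hall : ∀ x, (g * Equiv.swap a d).SameCycle a x := fun x => by
    by_cases hx : f.SameCycle a x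
    · exact hmono' _ _ (hmono _ _ hx)
    · exact had'.trans (hmono' _ _ ((hgb d had).symm.trans (hgb x hx)))
  exact (hall x).symm.trans (hall y)

theorem exists_cyclic_enumeration {n : ℕ} [NeZero n] (hα : Nat.card α = n)
    (hf : ∀ x y, f.SameCycle x y) :
    ∃ c : Fin n → α, Function.Bijective c ∧ ∀ i, c (i + 1) = f (c i) := by
  have := Fintype.ofFinite α
  rw [Nat.card_eq_fintype_card] at hα
  obtain ⟨x⟩ : Nonempty α := Fintype.card_pos_iff.1 (hα ▸ NeZero.pos n)
  have hcycle : f.IsCycleOn (Finset.univ : Finset α) :=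
    ⟨by simpa only [Finset.coe_univ] using Set.bijOn_univ.2 f.bijective, fun x _ y _ => hf x y⟩
  have hpow : ∀ k l : ℕ, (f ^ k) x = (f ^ l) x ↔ k ≡ l [MOD n] := fun k l => by
    rw [hcycle.pow_apply_eq_pow_apply (Finset.mem_univ x), Finset.card_univ, hα]
  refine ⟨fun i => (f ^ (i : ℕ)) x, ?_, fun i => ?_⟩
  · rw [Fintype.bijective_iff_injective_and_card, Fintype.card_fin]
    exact ⟨fun i j hij => Fin.ext (((hpow i j).1 hij).eq_of_lt_of_lt i.2 j.2), hα.symm⟩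
  · rw [← mul_apply, ← pow_succ', hpow, Fin.val_add, Fin.val_one']
    exact (Nat.mod_modEq _ n).trans ((Nat.mod_modEq 1 n).add_left i)

end Cycles

theorem addSelf_injective_of_odd_card {N : Type*} [AddCommGroup N] [Finite N]
    (hN : Odd (Nat.card N)) : Function.Injective fun x : N => x + x := fun x y hxy =>
  (nsmulCoprime (Nat.coprime_two_right.2 hN)).injective <| by
    simpa only [nsmulCoprime_apply, two_nsmul] using hxy

section Windmill

variable {n m : ℕ}

theorem windmillBlade_injective (j : Fin m) : Function.Injective (windmillBlade n m j) := by
  intro a b hab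
  unfold windmillBlade at hab
  split_ifs at hab with ha hb hb
  · simpa using hab
  · exact Fin.ext ((not_not.1 ha).trans (not_not.1 hb).symm)

theorem dutchWindmill_adj {x y : WindmillVertex n m} : (dutchWindmill n m).Adj x y ↔
    ∃ j i i', (SimpleGraph.cycleGraph n).Adj i i' ∧
      windmillBlade n m j i = x ∧ windmillBlade n m j i' = y := by
  rw [dutchWindmill, SimpleGraph.iSup_adj]
  refine exists_congr fun j => ⟨fun h => h.2, fun ⟨i, i', hadj, hx, hy⟩ =>
    ⟨?_, i, i', hadj, hx, hy⟩⟩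
  rw [← hx, ← hy]
  exact (windmillBlade_injective j).ne hadj.ne

theorem mem_edgeSet_dutchWindmill [NeZero n] (hn : 2 < n) {e : Sym2 (WindmillVertex n m)} :
    e ∈ (dutchWindmill n m).edgeSet ↔
      ∃ (j : Fin m) (i : Fin n), s(windmillBlade n m j i, windmillBlade n m j (i + 1)) = e := by
  obtain ⟨n, rfl⟩ : ∃ k, n = k + 2 := ⟨n - 2, by omega⟩
  induction e using Sym2.ind with
  | _ x y =>
  rw [SimpleGraph.mem_edgeSet, dutchWindmill_adj]
  constructor
  · rintro ⟨j, a, b, hab, rfl, rfl⟩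
    rcases SimpleGraph.cycleGraph_adj.1 hab with h | h
    · exact ⟨j, b, by rw [← h, add_sub_cancel, Sym2.eq_swap]⟩
    · exact ⟨j, a, by rw [← h, add_sub_cancel]⟩
  · rintro ⟨j, i, h⟩
    have hadj : (SimpleGraph.cycleGraph (n + 2)).Adj i (i + 1) :=
      SimpleGraph.cycleGraph_adj.2 (Or.inr (add_sub_cancel_left i 1))
    rcases Sym2.eq_iff.1 h with ⟨hx, hy⟩ | ⟨hy, hx⟩
    · exact ⟨j, i, i + 1, hadj, hx, hy⟩
    · exact ⟨j, i + 1, i, hadj.symm, hx, hy⟩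

variable {Γ K : Type*} [AddCommGroup Γ] [AddCommGroup K] [NeZero n]

/-- The vertex labelling of the windmill which carries the labels `a 0, …, a (n - 1)` of a cycle to
every blade, shifting the non-central vertices of the `j`-th blade by `h j`. -/
def windmillLabel (a : Fin n → Γ) (h : Fin m → Γ) : WindmillVertex n m → Γ
  | none => a 0
  | some (j, i) => a i + h j

theorem windmillLabel_windmillBlade (a : Fin n → Γ) (h : Fin m → Γ) (j : Fin m) (i : Fin n) :
    windmillLabel a h (windmillBlade n m j i) = a i + if i = 0 then 0 else h j := by
  by_cases hi : i = 0
  · subst hi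
    simp [windmillBlade, windmillLabel]
  · simp [windmillBlade, windmillLabel, hi]

theorem map_windmillLabel_windmillBlade {a : Fin n → Γ} {h : Fin m → Γ} (q : Γ →+ K)
    (hq : ∀ j, q (h j) = 0) (j : Fin m) (i : Fin n) :
    q (windmillLabel a h (windmillBlade n m j i)) = q (a i) := by
  rw [windmillLabel_windmillBlade, map_add]
  split_ifs <;> simp [hq]

theorem windmillLabel_injective {a : Fin n → Γ} {h : Fin m → Γ} (q : Γ →+ K)
    (hq : ∀ j, q (h j) = 0) (ha : Function.Injective fun i => q (a i))
    (hh : Function.Injective h) : Function.Injective (windmillLabel a h) := by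
  have index_eq : ∀ {i i' : Fin n} {x y : Γ}, q x = 0 → q y = 0 → a i + x = a i' + y → i = i' :=
    fun {i i'} {x y} hx hy hxy => ha (by simpa [hx, hy] using congrArg q hxy)
  have ne_zero : ∀ {i : Fin n}, (i : ℕ) ≠ 0 → i ≠ 0 := fun hi h => hi (by rw [h, Fin.val_zero])
  rintro (_ | ⟨j, i, hi⟩) (_ | ⟨j', i', hi'⟩) hxy
  · rfl
  · exact absurd (index_eq (hq j') (map_zero q) (by simpa [windmillLabel] using hxy.symm))
      (ne_zero hi')
  · exact absurd (index_eq (hq j) (map_zero q) (by simpa [windmillLabel] using hxy)) (ne_zero hi)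
  · obtain rfl : i = i' := index_eq (hq j) (hq j') hxy
    obtain rfl : j = j' := hh (add_left_cancel hxy)
    rfl

theorem windmillLabel_edge_injective (hn : 2 ≤ n) {a : Fin n → Γ} {h : Fin m → Γ} (q : Γ →+ K)
    (hq : ∀ j, q (h j) = 0) (ha : Function.Injective fun i => q (a i + a (i + 1)))
    (hh : Function.Injective h) (hh2 : Function.Injective fun j => h j + h j) :
    Function.Injective fun p : Fin m × Fin n => windmillLabel a h (windmillBlade n m p.1 p.2) +
      windmillLabel a h (windmillBlade n m p.1 (p.2 + 1)) := by
  rintro ⟨j, i⟩ ⟨j', i'⟩ hp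
  obtain rfl : i = i' := ha <| by
    simpa only [map_add, map_windmillLabel_windmillBlade q hq] using congrArg q hp
  have hshift : (if i = 0 then 0 else h j) + (if i + 1 = 0 then 0 else h j) =
      (if i = 0 then 0 else h j') + (if i + 1 = 0 then 0 else h j') := by
    refine add_left_cancel (a := a i + a (i + 1)) ?_
    simpa only [windmillLabel_windmillBlade, add_add_add_comm] using hp
  suffices j = j' by rw [this]
  by_cases hi : i = 0
  · have hi1 : i + 1 ≠ 0 := by
      rw [hi, zero_add, Ne, Fin.one_eq_zero_iff]
      omega
    exact hh (by simpa only [if_pos hi, if_neg hi1, zero_add] using hshift)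
  by_cases hi1 : i + 1 = 0
  · exact hh (by simpa only [if_neg hi, if_pos hi1, add_zero] using hshift)
  · exact hh2 (by simpa only [if_neg hi, if_neg hi1] using hshift)

end Windmill

theorem isHarmonious_dutchWindmill_of_quotient {Γ : Type*} [AddCommGroup Γ] [Finite Γ]
    {n m : ℕ} (hn : 2 < n) (hm : Odd m)
    {H : AddSubgroup Γ} (hH : Nat.card H = m) (hK : Nat.card (Γ ⧸ H) = n)
    {θ : Equiv.Perm (Γ ⧸ H)} (hθ : IsCompleteMapping θ) (hcycle : ∀ x y, θ.SameCycle x y) :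
    IsHarmonious (dutchWindmill n m) Γ := by
  have : NeZero n := ⟨by omega⟩
  obtain ⟨c, hc, hsucc⟩ := exists_cyclic_enumeration hK hcycle
  let q := QuotientAddGroup.mk' H
  let a : Fin n → Γ := fun i => (c i).out
  have hqa : ∀ i, q (a i) = c i := fun i => Quotient.out_eq (c i)
  let e : Fin m ≃ H := (Finite.equivFinOfCardEq hH).symm
  let h : Fin m → Γ := fun j => e j
  have hq : ∀ j, q (h j) = 0 := fun j => (QuotientAddGroup.eq_zero_iff _).2 (e j).2
  have hh : Function.Injective h := Subtype.val_injective.comp e.injective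
  have hh2 : Function.Injective fun j => h j + h j := Subtype.val_injective.comp
    ((addSelf_injective_of_odd_card (hH ▸ hm)).comp e.injective)
  have hsum : Function.Injective fun i => q (a i + a (i + 1)) := by
    simpa only [map_add, hqa, hsucc, Function.comp_def] using hθ.1.comp hc.1
  have hedge := windmillLabel_edge_injective hn.le q hq hsum hh hh2
  have hbij := (Nat.bijective_iff_injective_and_card _).2 ⟨hedge, by
    rw [Nat.card_prod, Nat.card_fin, Nat.card_fin, ← hH, ← hK, mul_comm,
      ← AddSubgroup.card_eq_card_quotient_mul_card_addSubgroup]⟩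
  refine ⟨windmillLabel a h, windmillLabel_injective q hq (by simpa only [hqa] using hc.1) hh,
    fun _ _ => Set.mem_univ _, fun e he e' he' hee' => ?_, fun γ _ => ?_⟩
  · obtain ⟨j, i, rfl⟩ := (mem_edgeSet_dutchWindmill hn).1 he
    obtain ⟨j', i', rfl⟩ := (mem_edgeSet_dutchWindmill hn).1 he'
    obtain ⟨rfl, rfl⟩ := Prod.ext_iff.1 (hedge (a₁ := (j, i)) (a₂ := (j', i')) hee')
    rfl
  · obtain ⟨⟨j, i⟩, hγ⟩ := hbij.2 γ
    exact ⟨_, (mem_edgeSet_dutchWindmill hn).2 ⟨j, i, rfl⟩, hγ⟩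

section SkewProduct

variable {Q N : Type*}

/-- The skew product of a permutation `σ` of the base `Q` with permutations `ψ q` mapping the fibre
over `q` to the fibre over `σ q`. -/
def skewProduct (σ : Equiv.Perm Q) (ψ : Q → Equiv.Perm N) : Equiv.Perm (Q × N) :=
  Equiv.prodShear σ ψ

theorem skewProduct_apply (σ : Equiv.Perm Q) (ψ : Q → Equiv.Perm N) (q : Q) (x : N) :
    skewProduct σ ψ (q, x) = (σ q, ψ q x) := rfl

theorem skewProduct_conj_apply (σ : Equiv.Perm Q) (C φ : Q → Equiv.Perm N) (q : Q) (x : N) :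
    skewProduct σ (fun q => φ (σ q) * C q * (φ q)⁻¹) (q, φ q x) = (σ q, φ (σ q) (C q x)) := by
  simp only [skewProduct_apply, Equiv.Perm.mul_apply, Equiv.Perm.coe_inv, Equiv.symm_apply_apply]

variable [Finite Q] {σ : Equiv.Perm Q} {b : Q → Q} {C φ : Q → Equiv.Perm N}

theorem sameCycle_skewProduct_base (hb : ∀ q, σ.SameCycle (b q) q) (hbσ : ∀ q, b (σ q) = b q)
    (hC : ∀ q, b q ≠ q → C q = 1) (q : Q) (x : N) :
    (skewProduct σ fun q => φ (σ q) * C q * (φ q)⁻¹).SameCycle (q, φ q x) (b q, φ (b q) x) := by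
  set E := skewProduct σ fun q => φ (σ q) * C q * (φ q)⁻¹ with hE
  refine rel_of_sameCycle_of_ne
    (r := (Equiv.Perm.SameCycle.setoid E).comap fun q => (q, φ q x)) (fun p hp hne => ?_) (hb q)
  have hbp : b p ≠ p := by
    rw [apply_eq_of_sameCycle hbσ hp, apply_eq_of_sameCycle hbσ (hb q).symm]
    exact hne.symm
  change E.SameCycle (p, φ p x) (σ p, φ (σ p) x)
  have hEp : E (p, φ p x) = (σ p, φ (σ p) x) := by
    rw [hE, skewProduct_conj_apply, hC p hbp, Equiv.Perm.one_apply]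
  exact hEp ▸ (Equiv.Perm.SameCycle.refl E (p, φ p x)).apply_right

variable [Finite N]

theorem sameCycle_of_sameCycle_skewProduct (hbσ : ∀ q, b (σ q) = b q)
    (hC : ∀ q, b q ≠ q → C q = 1) {q q' : Q} {x y : N}
    (h : (skewProduct σ fun q => φ (σ q) * C q * (φ q)⁻¹).SameCycle (q, φ q x) (q', φ q' y)) :
    b q = b q' ∧ (C (b q)).SameCycle x y := by
  suffices (q', φ q' y) ∈ {p : Q × N | b q = b p.1 ∧ (C (b q)).SameCycle x ((φ p.1).symm p.2)} by
    simpa only [Set.mem_ofPred_eq, Equiv.symm_apply_apply] using this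
  refine mem_of_sameCycle (fun p hp => ?_) h
    ⟨rfl, by simp only [Equiv.symm_apply_apply, Equiv.Perm.SameCycle.refl]⟩
  obtain ⟨p, z⟩ := p
  obtain ⟨z, rfl⟩ := (φ p).surjective z
  obtain ⟨hbp, hz⟩ : b q = b p ∧ (C (b q)).SameCycle x z := by
    simpa only [Set.mem_ofPred_eq, Equiv.symm_apply_apply] using hp
  rw [skewProduct_conj_apply, Set.mem_ofPred_eq, Equiv.symm_apply_apply, hbσ]
  refine ⟨hbp, ?_⟩
  by_cases hp : b p = p
  · rw [hbp, hp] at hz ⊢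
    exact Equiv.Perm.sameCycle_apply_right.2 hz
  · rwa [hC p hp]

/-- Conjugation by `φ` makes the fibre maps trivial except over the base points `b q`, one on each
cycle of `σ`, where the first return map is `C (b q)`. -/
theorem sameCycle_skewProduct_iff (hb : ∀ q, σ.SameCycle (b q) q) (hbσ : ∀ q, b (σ q) = b q)
    (hC : ∀ q, b q ≠ q → C q = 1) {q q' : Q} {x y : N} :
    (skewProduct σ fun q => φ (σ q) * C q * (φ q)⁻¹).SameCycle (q, φ q x) (q', φ q' y) ↔
      b q = b q' ∧ (C (b q)).SameCycle x y := by
  refine ⟨sameCycle_of_sameCycle_skewProduct hbσ hC, fun ⟨hqq', hxy⟩ => ?_⟩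
  have to_base := sameCycle_skewProduct_base (φ := φ) hb hbσ hC
  set E := skewProduct σ fun q => φ (σ q) * C q * (φ q)⁻¹ with hE
  have hbb : b (b q) = b q := apply_eq_of_sameCycle hbσ (hb q).symm
  have hreturn : E.SameCycle (b q, φ (b q) y) (b q, φ (b q) x) := rel_of_sameCycle_of_ne
    (r := (Equiv.Perm.SameCycle.setoid E).comap fun z => (b q, φ (b q) z)) (fun z _ _ => by
      have hz := (Equiv.Perm.SameCycle.refl E (b q, φ (b q) z)).apply_right
      rw [hE, skewProduct_conj_apply, ← hE] at hz
      have := hz.trans (to_base (σ (b q)) (C (b q) z))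
      rwa [hbσ, hbb] at this) hxy
  have hy := to_base q' y
  rw [← hqq'] at hy
  exact (to_base q x).trans (hreturn.symm.trans hy.symm)

end SkewProduct

section CompleteMapping

variable {K : Type*} [AddCommGroup K] {θ : Equiv.Perm K}

namespace IsCompleteMapping

theorem inv (h : IsCompleteMapping θ) : IsCompleteMapping θ⁻¹ := by
  have : (fun x => x + θ⁻¹ x) = (fun x => x + θ x) ∘ (θ⁻¹ : Equiv.Perm K) := by
    funext x
    simp only [Function.comp_apply, Equiv.Perm.coe_inv, Equiv.apply_symm_apply, add_comm]
  rw [IsCompleteMapping, this]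
  exact h.comp θ⁻¹.bijective

theorem permCongr {L : Type*} [AddCommGroup L] (h : IsCompleteMapping θ) (e : K ≃+ L) :
    IsCompleteMapping (e.toEquiv.permCongr θ) := by
  have : (fun x => x + e.toEquiv.permCongr θ x) = e ∘ (fun x => x + θ x) ∘ e.symm := by
    funext x
    simp [Equiv.permCongr_apply]
  rw [IsCompleteMapping, this]
  exact e.bijective.comp (h.comp e.symm.bijective)

theorem mul_of_sum_eq {τ π : Equiv.Perm K} (h : IsCompleteMapping θ)
    (hτ : ∀ x, x + θ (τ x) = π x + θ (π x)) : IsCompleteMapping (θ * τ) := by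
  have : (fun x => x + (θ * τ) x) = (fun x => x + θ x) ∘ π := funext hτ
  rw [IsCompleteMapping, this]
  exact h.comp π.bijective

theorem mul_viaEmbedding {ι : Type*} (h : IsCompleteMapping θ) (node : ι ↪ K)
    {τ π : Equiv.Perm ι}
    (hτ : ∀ i, node i + θ (node (τ i)) = node (π i) + θ (node (π i))) :
    IsCompleteMapping (θ * τ.viaEmbedding node) := by
  refine h.mul_of_sum_eq (π := π.viaEmbedding node) fun x => ?_
  by_cases hx : x ∈ Set.range node
  · obtain ⟨i, rfl⟩ := hx
    rw [Equiv.Perm.viaEmbedding_apply, Equiv.Perm.viaEmbedding_apply, hτ]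
  · rw [Equiv.Perm.viaEmbedding_apply_of_notMem _ _ _ hx,
      Equiv.Perm.viaEmbedding_apply_of_notMem _ _ _ hx]

open Equiv in
/-- Exchanging the successors of `R₀` and `R₃` and those of `R₁` and `R₂` only permutes the four
sums at these points; the fourth equation `R₀ + θ R₃ = R₂ + θ R₂` follows from the other three. -/
theorem mul_swap_mul_swap [DecidableEq K] (h : IsCompleteMapping θ) {R₀ R₁ R₂ R₃ : K}
    (h₁₂ : R₁ + θ R₂ = R₃ + θ R₃) (h₂₁ : R₂ + θ R₁ = R₀ + θ R₀) (h₃₀ : R₃ + θ R₀ = R₁ + θ R₁)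
    (hn₀₁ : R₀ ≠ R₁) (hn₀₂ : R₀ ≠ R₂) (hn₀₃ : R₀ ≠ R₃) (hn₁₂ : R₁ ≠ R₂) :
    IsCompleteMapping (θ * Equiv.swap R₁ R₂ * Equiv.swap R₀ R₃) := by
  have h₀₃ : R₀ + θ R₃ = R₂ + θ R₂ := by linear_combination (norm := module) -h₁₂ - h₂₁ - h₃₀
  have hn₂₃ : R₂ ≠ R₃ := by
    rintro rfl
    exact hn₁₂ (add_right_cancel h₁₂)
  have hn₁₃ : R₁ ≠ R₃ := by
    rintro rfl
    exact hn₁₂ (θ.injective (add_left_cancel h₁₂)).symm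
  rw [mul_assoc]
  refine h.mul_of_sum_eq (π := Equiv.swap R₀ R₂ * Equiv.swap R₁ R₃) fun x => ?_
  simp only [Equiv.Perm.mul_apply]
  rcases eq_or_ne x R₀ with rfl | hx₀
  · rwa [swap_apply_left x R₃, swap_apply_of_ne_of_ne hn₁₃.symm hn₂₃.symm,
      swap_apply_of_ne_of_ne hn₀₁ hn₀₃, swap_apply_left]
  rcases eq_or_ne x R₁ with rfl | hx₁
  · rwa [swap_apply_of_ne_of_ne hn₀₁.symm hn₁₃, swap_apply_left, swap_apply_left,
      swap_apply_of_ne_of_ne hn₀₃.symm hn₂₃.symm]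
  rcases eq_or_ne x R₂ with rfl | hx₂
  · rwa [swap_apply_of_ne_of_ne hn₀₂.symm hn₂₃, swap_apply_right,
      swap_apply_of_ne_of_ne hn₁₂.symm hn₂₃, swap_apply_right]
  rcases eq_or_ne x R₃ with rfl | hx₃
  · rwa [swap_apply_right, swap_apply_of_ne_of_ne hn₀₁ hn₀₂, swap_apply_right,
      swap_apply_of_ne_of_ne hn₀₁.symm hn₁₂]
  · rw [swap_apply_of_ne_of_ne hx₀ hx₃, swap_apply_of_ne_of_ne hx₁ hx₂,
      swap_apply_of_ne_of_ne hx₁ hx₃, swap_apply_of_ne_of_ne hx₀ hx₂]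

theorem exists_oneCycle_of_trade [Finite K] (h : IsCompleteMapping θ) {R₀ R₁ R₂ R₃ : K}
    (h₁₂ : R₁ + θ R₂ = R₃ + θ R₃) (h₂₁ : R₂ + θ R₁ = R₀ + θ R₀) (h₃₀ : R₃ + θ R₀ = R₁ + θ R₁)
    (hn₀₁ : ¬ θ.SameCycle R₀ R₁) (hn₀₂ : ¬ θ.SameCycle R₀ R₂) (hn₀₃ : ¬ θ.SameCycle R₀ R₃)
    (hn₁₂ : ¬ θ.SameCycle R₁ R₂)
    (hcover : ∀ x, θ.SameCycle R₀ x ∨ θ.SameCycle R₁ x ∨ θ.SameCycle R₂ x) :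
    ∃ θ' : Equiv.Perm K, IsCompleteMapping θ' ∧ ∀ x y, θ'.SameCycle x y := by
  classical
  have ne_of : ∀ {x y}, ¬ θ.SameCycle x y → x ≠ y := fun hxy h =>
    hxy (h ▸ Equiv.Perm.SameCycle.refl θ _)
  exact ⟨_, h.mul_swap_mul_swap h₁₂ h₂₁ h₃₀ (ne_of hn₀₁) (ne_of hn₀₂) (ne_of hn₀₃) (ne_of hn₁₂),
    sameCycle_mul_swap_mul_swap hn₀₁ hn₀₂ hn₀₃ hn₁₂ hcover⟩

theorem exists_add_eq {Q : Type*} [AddCommGroup Q] {π : K →+ Q} {θ : Equiv.Perm π.ker}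
    (h : IsCompleteMapping θ) {x : K} (hx : π x = 0) : ∃ n : π.ker, (n : K) + θ n = x := by
  obtain ⟨n, hn⟩ := h.2 ⟨x, hx⟩
  exact ⟨n, congrArg Subtype.val hn⟩

end IsCompleteMapping

theorem isCompleteMapping_addRight [Finite K] (hK : Odd (Nat.card K)) (c : K) :
    IsCompleteMapping (Equiv.addRight c) := by
  refine Finite.injective_iff_bijective.1 fun x y hxy => addSelf_injective_of_odd_card hK ?_
  simpa only [Equiv.coe_addRight, ← add_assoc, add_left_inj] using hxy

theorem isCompleteMapping_one [Finite K] (hK : Odd (Nat.card K)) :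
    IsCompleteMapping (1 : Equiv.Perm K) := by
  simpa only [Equiv.addRight_zero] using isCompleteMapping_addRight hK 0

theorem sameCycle_addRight {g : K} (hg : ∀ x, x ∈ AddSubgroup.zmultiples g) (x y : K) :
    (Equiv.addRight g).SameCycle x y := by
  obtain ⟨k, hk⟩ := AddSubgroup.mem_zmultiples_iff.1 (hg (y - x))
  refine ⟨k, ?_⟩
  rw [Equiv.zsmul_addRight, hk, Equiv.coe_addRight]
  exact add_sub_cancel x y

theorem IsSplittable.of_addEquiv {L : Type*} [AddCommGroup L] (e : K ≃+ L) (h : IsSplittable K) :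
    IsSplittable L := by
  obtain ⟨⟨θ, hθ, hall⟩, G, hG, u, v, hne, hcover⟩ := h
  have conj : ∀ {f : Equiv.Perm K} {x y : L},
      (e.toEquiv.permCongr f).SameCycle x y ↔ f.SameCycle (e.symm x) (e.symm y) := fun {f x y} => by
    simpa using sameCycle_permCongr (f := f) e.toEquiv (x := e.symm x) (y := e.symm y)
  refine ⟨⟨_, hθ.permCongr e, fun x y => conj.2 (hall _ _)⟩, _, hG.permCongr e, e u, e v, ?_,
    fun x => ?_⟩
  · simpa only [conj, e.symm_apply_apply] using hne
  · simpa only [conj, e.symm_apply_apply] using hcover (e.symm x)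

end CompleteMapping

section Level

variable {K Q : Type*} [AddCommGroup K] [AddCommGroup Q] {π : K →+ Q} {t : Q → K}

/-- Coordinates on an extension of `Q` given by the choice `t` of coset representatives. -/
def levelEquiv (ht : ∀ q, π (t q) = q) : Q × π.ker ≃ K where
  toFun p := t p.1 + p.2
  invFun k := (π k, ⟨k - t (π k), by rw [AddMonoidHom.mem_ker, map_sub, ht, sub_self]⟩)
  left_inv := by
    rintro ⟨q, x, hx⟩
    have hx' : π x = 0 := hx
    ext <;> simp [ht, hx']
  right_inv k := by simp

theorem levelEquiv_apply (ht : ∀ q, π (t q) = q) (q : Q) (x : π.ker) :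
    levelEquiv ht (q, x) = t q + x := rfl

theorem map_levelEquiv (ht : ∀ q, π (t q) = q) (p : Q × π.ker) : π (levelEquiv ht p) = p.1 :=
  congrArg Prod.fst ((levelEquiv ht).symm_apply_apply p)

/-- The skew product of `σ` and `ψ` as a permutation of an extension of `Q`. -/
def levelPerm (ht : ∀ q, π (t q) = q) (σ : Equiv.Perm Q) (ψ : Q → Equiv.Perm π.ker) :
    Equiv.Perm K :=
  (levelEquiv ht).permCongr (skewProduct σ ψ)

theorem levelPerm_apply (ht : ∀ q, π (t q) = q) (σ : Equiv.Perm Q) (ψ : Q → Equiv.Perm π.ker)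
    (q : Q) (x : π.ker) :
    levelPerm ht σ ψ (levelEquiv ht (q, x)) = levelEquiv ht (σ q, ψ q x) := by
  rw [levelPerm, Equiv.permCongr_apply, Equiv.symm_apply_apply, skewProduct_apply]

theorem isCompleteMapping_levelPerm [Finite K] (ht : ∀ q, π (t q) = q) {σ : Equiv.Perm Q}
    {ψ : Q → Equiv.Perm π.ker} (hσ : IsCompleteMapping σ) (hψ : ∀ q, IsCompleteMapping (ψ q)) :
    IsCompleteMapping (levelPerm ht σ ψ) := by
  refine Finite.injective_iff_bijective.1 fun k k' hkk' => ?_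
  obtain ⟨⟨q, x⟩, rfl⟩ := (levelEquiv ht).surjective k
  obtain ⟨⟨q', x'⟩, rfl⟩ := (levelEquiv ht).surjective k'
  simp only [levelPerm_apply] at hkk'
  obtain rfl : q = q' := hσ.1 <| by
    simpa only [map_add, map_levelEquiv] using congrArg π hkk'
  suffices x + ψ q x = x' + ψ q x' by rw [(hψ q).1 this]
  rw [levelEquiv_apply, levelEquiv_apply, levelEquiv_apply, levelEquiv_apply, add_add_add_comm,
    add_add_add_comm (t q) (x' : K)] at hkk'
  exact Subtype.ext (add_left_cancel hkk')

end Level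

section Extension

variable {K Q : Type*} [AddCommGroup K] [Finite K] [AddCommGroup Q] [Finite Q] {π : K →+ Q}

theorem sameCycle_levelPerm_iff {t : Q → K} (ht : ∀ q, π (t q) = q) {σ : Equiv.Perm Q} {b : Q → Q}
    {C φ : Q → Equiv.Perm π.ker} (hb : ∀ q, σ.SameCycle (b q) q) (hbσ : ∀ q, b (σ q) = b q)
    (hC : ∀ q, b q ≠ q → C q = 1) {q q' : Q} {x y : π.ker} :
    (levelPerm ht σ fun q => φ (σ q) * C q * (φ q)⁻¹).SameCycle (levelEquiv ht (q, φ q x))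
      (levelEquiv ht (q', φ q' y)) ↔ b q = b q' ∧ (C (b q)).SameCycle x y :=
  (sameCycle_permCongr _).trans (sameCycle_skewProduct_iff hb hbσ hC)

theorem IsCompleteMapping.exists_lift_of_cyclic_odd_ker {σ : Equiv.Perm Q}
    (hσ : IsCompleteMapping σ) (hπ : Function.Surjective π) (hodd : Odd (Nat.card π.ker))
    {g : π.ker} (hg : ∀ x, x ∈ AddSubgroup.zmultiples g) :
    ∃ θ : Equiv.Perm K, IsCompleteMapping θ ∧
      ∀ k k', θ.SameCycle k k' ↔ σ.SameCycle (π k) (π k') := by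
  classical
  let b : Q → Q := fun q => (Quotient.mk (Equiv.Perm.SameCycle.setoid σ) q).out
  have hb : ∀ q, σ.SameCycle (b q) q := fun q =>
    Quotient.mk_out (s := Equiv.Perm.SameCycle.setoid σ) q
  have hb_eq : ∀ q q', b q = b q' ↔ σ.SameCycle q q' := fun q q' =>
    Quotient.out_inj.trans (Quotient.eq (r := Equiv.Perm.SameCycle.setoid σ))
  let C : Q → Equiv.Perm π.ker := fun q => if b q = q then Equiv.addRight g else 1
  have hC : ∀ q, IsCompleteMapping (C q) := fun q => by
    unfold C
    split_ifs
    exacts [isCompleteMapping_addRight hodd g, isCompleteMapping_one hodd]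
  have ht : ∀ q, π (Function.surjInv hπ q) = q := Function.surjInv_eq hπ
  refine ⟨levelPerm ht σ fun q => (1 : Equiv.Perm π.ker) * C q * (1 : Equiv.Perm π.ker)⁻¹,
    isCompleteMapping_levelPerm ht hσ fun q => by simpa only [one_mul, inv_one, mul_one] using hC q,
    fun k k' => ?_⟩
  obtain ⟨⟨q, x⟩, rfl⟩ := (levelEquiv ht).surjective k
  obtain ⟨⟨q', x'⟩, rfl⟩ := (levelEquiv ht).surjective k'
  have hbσ : ∀ q, b (σ q) = b q := fun q =>
    (hb_eq _ _).2 (Equiv.Perm.sameCycle_apply_left.2 (Equiv.Perm.SameCycle.refl σ q))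
  have hcycle : (C (b q)).SameCycle x x' := by
    have hbb : b (b q) = b q := (hb_eq _ _).2 (hb q)
    simpa only [C, if_pos hbb] using sameCycle_addRight hg x x'
  rw [map_levelEquiv, map_levelEquiv, ← hb_eq]
  exact (sameCycle_levelPerm_iff (φ := fun _ => 1) ht hb hbσ fun q hq => if_neg hq).trans
    (and_iff_left hcycle)

theorem IsSplittable.of_cyclic_odd_ker (hπ : Function.Surjective π)
    (hodd : Odd (Nat.card π.ker)) {g : π.ker} (hg : ∀ x, x ∈ AddSubgroup.zmultiples g)
    (h : IsSplittable Q) : IsSplittable K := by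
  obtain ⟨⟨σ, hσ, hall⟩, G, hG, u, v, hne, hcover⟩ := h
  obtain ⟨θ, hθ, hθσ⟩ := hσ.exists_lift_of_cyclic_odd_ker hπ hodd hg
  obtain ⟨G', hG', hGG'⟩ := hG.exists_lift_of_cyclic_odd_ker hπ hodd hg
  obtain ⟨u, rfl⟩ := hπ u
  obtain ⟨v, rfl⟩ := hπ v
  simp only [← hGG'] at hne
  refine ⟨⟨θ, hθ, fun x y => (hθσ x y).2 (hall _ _)⟩, G', hG', u, v, hne, fun x => ?_⟩
  simpa only [hGG'] using hcover (π x)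

end Extension

/-- The permutation `σ` fixes `0`, and the nonzero elements form one cycle, the cycle of `a`. -/
structure IsCyclicOffZero {Q : Type*} [Zero Q] (σ : Equiv.Perm Q) (a : Q) : Prop where
  map_zero : σ 0 = 0
  ne_zero : a ≠ 0
  sameCycle : ∀ q, q ≠ 0 → σ.SameCycle a q

section CyclicOffZero

variable {K Q : Type*} [AddCommGroup K] [AddCommGroup Q] [DecidableEq Q] {π : K →+ Q} {t : Q → K}
  {σ : Equiv.Perm Q} {a : Q}

/-- The fibre maps which are `θ` over `0` and whose first return map over `a` is `G`, conjugated
by `φ`. -/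
def fibreMap {N : Type*} (σ : Equiv.Perm Q) (a : Q) (θ G : Equiv.Perm N) (φ : Q → Equiv.Perm N)
    (q : Q) : Equiv.Perm N :=
  φ (σ q) * (if q = 0 then θ else if q = a then G else 1) * (φ q)⁻¹

theorem levelPerm_fibreMap_apply (ht : ∀ q, π (t q) = q) (θ G : Equiv.Perm π.ker)
    (φ : Q → Equiv.Perm π.ker) (q : Q) (x : π.ker) :
    levelPerm ht σ (fibreMap σ a θ G φ) (levelEquiv ht (q, φ q x)) =
      levelEquiv ht (σ q, φ (σ q) ((if q = 0 then θ else if q = a then G else 1) x)) := by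
  rw [levelPerm_apply, fibreMap, Equiv.Perm.mul_apply, Equiv.Perm.mul_apply, Equiv.Perm.coe_inv,
    Equiv.symm_apply_apply]

variable [Finite K] [Finite Q]

theorem IsCyclicOffZero.sameCycle_levelPerm_iff (hσ : IsCyclicOffZero σ a) (ht : ∀ q, π (t q) = q)
    {θ G : Equiv.Perm π.ker} {φ : Q → Equiv.Perm π.ker} {q q' : Q} {x y : π.ker} :
    (levelPerm ht σ (fibreMap σ a θ G φ)).SameCycle (levelEquiv ht (q, φ q x))
      (levelEquiv ht (q', φ q' y)) ↔
        (q = 0 ↔ q' = 0) ∧ (if q = 0 then θ else G).SameCycle x y := by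
  have hσ_zero : ∀ q, σ q = 0 ↔ q = 0 := fun q => by
    rw [← σ.injective.eq_iff (a := q), hσ.map_zero]
  refine (_root_.sameCycle_levelPerm_iff (b := fun q => if q = 0 then 0 else a) ht (fun q => ?_)
    (fun q => ?_) fun q hq => ?_).trans (and_congr ?_ ?_)
  · split_ifs with h
    · rw [h]
    · exact hσ.sameCycle q h
  · simp only [hσ_zero]
  · by_cases h : q = 0
    · exact absurd (by simp only [h, if_true]) hq
    · simp only [h, if_false] at hq ⊢
      rw [if_neg (Ne.symm hq)]
  · by_cases h : q = 0 <;> by_cases h' : q' = 0 <;> simp [h, h', hσ.ne_zero, hσ.ne_zero.symm]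
  · by_cases h : q = 0 <;> simp [h, hσ.ne_zero]

theorem IsCyclicOffZero.exists_twoCycle (hσ : IsCyclicOffZero σ a) (hσc : IsCompleteMapping σ)
    (ht : ∀ q, π (t q) = q) {θ : Equiv.Perm π.ker} {φ : Q → Equiv.Perm π.ker}
    (hψ : ∀ q, IsCompleteMapping (fibreMap σ a θ θ φ q)) (hθ : ∀ x y, θ.SameCycle x y) :
    ∃ F : Equiv.Perm K, IsCompleteMapping F ∧
      ∃ u v, ¬ F.SameCycle u v ∧ ∀ x, F.SameCycle u x ∨ F.SameCycle v x := by
  refine ⟨_, isCompleteMapping_levelPerm ht hσc hψ, levelEquiv ht (0, φ 0 0),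
    levelEquiv ht (a, φ a 0), ?_, fun k => ?_⟩
  · simp only [hσ.sameCycle_levelPerm_iff, hσ.ne_zero, true_iff, false_and, not_false_eq_true]
  · obtain ⟨⟨q, x⟩, rfl⟩ := (levelEquiv ht).surjective k
    obtain ⟨x, rfl⟩ := (φ q).surjective x
    simp only [hσ.sameCycle_levelPerm_iff, ite_self, hθ, and_true, hσ.ne_zero, true_iff, false_iff]
    exact em (q = 0)

theorem IsCyclicOffZero.exists_oneCycle (hσ : IsCyclicOffZero σ a) (hσc : IsCompleteMapping σ)
    (ht : ∀ q, π (t q) = q) {θ G : Equiv.Perm π.ker} {φ : Q → Equiv.Perm π.ker}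
    (hψ : ∀ q, IsCompleteMapping (fibreMap σ a θ G φ q)) (hθ : ∀ x y, θ.SameCycle x y)
    {n₁ n₂ : π.ker} (hne : ¬ G.SameCycle n₁ n₂)
    (hcover : ∀ x, G.SameCycle n₁ x ∨ G.SameCycle n₂ x) {c : Q} (hφ₀ : φ 0 = 1) (hφa : φ a = 1)
    (hφσa : φ (σ a) = 1) (hσa₀ : σ a ≠ 0) (hσa : σ a ≠ a) (hc₀ : c ≠ 0) (hca : c ≠ a)
    {n₀ n₃ : π.ker}
    (h₁₂ : t a + n₁ + (t (σ (σ a)) + φ (σ (σ a)) n₂) = t c + φ c n₃ + (t (σ c) + φ (σ c) n₃))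
    (h₂₁ : t (σ a) + n₂ + (t (σ a) + G n₁) = t 0 + n₀ + (t 0 + θ n₀))
    (h₃₀ : t c + φ c n₃ + (t 0 + θ n₀) = t a + n₁ + (t (σ a) + G n₁)) :
    ∃ F : Equiv.Perm K, IsCompleteMapping F ∧ ∀ x y, F.SameCycle x y := by
  have cycle_iff := @hσ.sameCycle_levelPerm_iff (ht := ht) (θ := θ) (G := G) (φ := φ)
  have apply := levelPerm_fibreMap_apply (σ := σ) (a := a) ht θ G φ
  refine (isCompleteMapping_levelPerm ht hσc hψ).exists_oneCycle_of_trade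
    (R₀ := levelEquiv ht (0, φ 0 n₀)) (R₁ := levelEquiv ht (a, φ a n₁))
    (R₂ := levelEquiv ht (σ a, φ (σ a) n₂)) (R₃ := levelEquiv ht (c, φ c n₃))
    ?_ ?_ ?_ ?_ ?_ ?_ ?_ fun k => ?_
  · rw [apply, apply]
    simpa [levelEquiv_apply, hφa, hσa₀, hσa, hc₀, hca] using h₁₂
  · rw [apply, apply]
    simpa [levelEquiv_apply, hφ₀, hφσa, hσ.ne_zero, hσ.map_zero] using h₂₁
  · rw [apply, apply]
    simpa [levelEquiv_apply, hφ₀, hφa, hφσa, hσ.ne_zero, hσ.map_zero] using h₃₀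
  · simp [cycle_iff, hσ.ne_zero]
  · simp [cycle_iff, hσa₀]
  · simp [cycle_iff, hc₀]
  · simp [cycle_iff, hσ.ne_zero, hσa₀, hne]
  · obtain ⟨⟨q, x⟩, rfl⟩ := (levelEquiv ht).surjective k
    obtain ⟨x, rfl⟩ := (φ q).surjective x
    simp only [cycle_iff, hσ.ne_zero, hσa₀, hθ, true_iff, false_iff, if_true, if_false, and_true,
      ← and_or_left]
    exact (em (q = 0)).imp_right fun hq => ⟨hq, hcover x⟩

end CyclicOffZero

section KleinOcto

/-- The automorphism of order three of the Klein four-group. -/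
def kleinPerm : Equiv.Perm (ZMod 2 × ZMod 2) where
  toFun p := (p.2, p.1 + p.2)
  invFun p := (p.1 + p.2, p.1)
  left_inv := by unfold Function.LeftInverse; decide
  right_inv := by unfold Function.RightInverse Function.LeftInverse; decide

theorem isCompleteMapping_kleinPerm : IsCompleteMapping kleinPerm := by
  refine Finite.injective_iff_bijective.1 ?_
  unfold Function.Injective
  decide

theorem isCyclicOffZero_kleinPerm : IsCyclicOffZero kleinPerm (1, 0) := by
  refine ⟨rfl, by decide, fun q hq => ?_⟩
  obtain ⟨k, hk⟩ : ∃ k : Fin 3, (kleinPerm ^ k.1) (1, 0) = q := by decide +revert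
  exact ⟨k.1, by rwa [zpow_natCast]⟩

/-- An automorphism of order seven of the elementary Abelian group of order eight. -/
def octoPerm : Equiv.Perm (ZMod 2 × ZMod 2 × ZMod 2) where
  toFun p := (p.2.2, p.1 + p.2.2, p.2.1)
  invFun p := (p.1 + p.2.1, p.2.2, p.1)
  left_inv := by unfold Function.LeftInverse; decide
  right_inv := by unfold Function.RightInverse Function.LeftInverse; decide

theorem isCompleteMapping_octoPerm : IsCompleteMapping octoPerm := by
  refine Finite.injective_iff_bijective.1 ?_
  unfold Function.Injective
  decide

theorem isCyclicOffZero_octoPerm : IsCyclicOffZero octoPerm (1, 0, 0) := by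
  refine ⟨rfl, by decide, fun q hq => ?_⟩
  obtain ⟨k, hk⟩ : ∃ k : Fin 7, (octoPerm ^ k.1) (1, 0, 0) = q := by decide +revert
  exact ⟨k.1, by rwa [zpow_natCast]⟩

variable {K : Type*} [AddCommGroup K]

theorem map_update_section {Q : Type*} [AddCommGroup Q] [DecidableEq Q] {π : K →+ Q} {s : Q → K}
    (hs : ∀ q, π (s q) = q) {a : Q} {k : K} (hk : π k = a) (q : Q) :
    π (Function.update s a k q) = q := by
  rcases eq_or_ne q a with rfl | hq
  · rwa [Function.update_self]
  · rw [Function.update_of_ne hq, hs]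

theorem isCompleteMapping_fibreMap_kleinPerm {N : Type*} [AddCommGroup N] {θ G ρ : Equiv.Perm N}
    (hθ : IsCompleteMapping θ) (hG : IsCompleteMapping G) (hρ : IsCompleteMapping ρ)
    (q : ZMod 2 × ZMod 2) :
    IsCompleteMapping
      (fibreMap kleinPerm (1, 0) θ G (fun q => if q = (1, 1) then ρ⁻¹ else 1) q) := by
  have hq : q = (0, 0) ∨ q = (1, 0) ∨ q = (0, 1) ∨ q = (1, 1) := by decide +revert
  rcases hq with rfl | rfl | rfl | rfl
  · change IsCompleteMapping (1 * θ * 1⁻¹)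
    rwa [inv_one, one_mul, mul_one]
  · change IsCompleteMapping (1 * G * 1⁻¹)
    rwa [inv_one, one_mul, mul_one]
  · change IsCompleteMapping (ρ⁻¹ * 1 * 1⁻¹)
    rw [inv_one, mul_one, mul_one]
    exact hρ.inv
  · change IsCompleteMapping (1 * 1 * ρ⁻¹⁻¹)
    rwa [inv_inv, one_mul, one_mul]

variable [Finite K]

theorem IsSplittable.of_klein_quotient {π : K →+ ZMod 2 × ZMod 2} (hπ : Function.Surjective π)
    (h : IsSplittable π.ker) : IsSplittable K := by
  obtain ⟨⟨θ, hθ, hθall⟩, G, hG, n₁, n₂, hne, hcover⟩ := h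
  obtain ⟨s, hs⟩ : ∃ s : ZMod 2 × ZMod 2 → K, ∀ q, π (s q) = q :=
    ⟨Function.surjInv hπ, Function.surjInv_eq hπ⟩
  have hfibre {ψ : Equiv.Perm π.ker} (hψ : IsCompleteMapping ψ) :=
    isCompleteMapping_fibreMap_kleinPerm hθ hψ hθ
  refine ⟨?_, isCyclicOffZero_kleinPerm.exists_twoCycle isCompleteMapping_kleinPerm hs (hfibre hθ)
    hθall⟩
  have hker : ∀ x : π.ker, π x = 0 := fun x => x.2
  obtain ⟨n₃, hn₃⟩ := hθ.inv.2 (n₁ + θ⁻¹ n₂)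
  obtain ⟨n₀, hn₀⟩ := hθ.exists_add_eq (π := π)
    (x := s (0, 1) + n₂ + (s (0, 1) + G n₁) - (s 0 + s 0)) (by
      simp only [map_add, map_sub, hs, hker]; decide)
  obtain ⟨k, hk⟩ : ∃ k : K, k = s (1, 1) + θ⁻¹ n₃ + (s 0 + θ n₀) - (n₁ + (s (0, 1) + G n₁)) :=
    ⟨_, rfl⟩
  have hπk : π k = (1, 0) := by
    rw [hk]
    simp only [map_add, map_sub, hs, hker]
    decide
  refine isCyclicOffZero_kleinPerm.exists_oneCycle isCompleteMapping_kleinPerm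
    (map_update_section hs hπk) (hfibre hG) hθall hne hcover (c := (1, 1)) rfl rfl rfl (by decide)
    (by decide) (by decide) (by decide) (n₀ := n₀) (n₃ := n₃) ?_ ?_ ?_
  · change k + n₁ + (s (1, 1) + (θ⁻¹ n₂ : π.ker)) = s (1, 1) + (θ⁻¹ n₃ : π.ker) + (k + n₃)
    have hn₃' : (n₃ : K) + (θ⁻¹ n₃ : π.ker) = n₁ + (θ⁻¹ n₂ : π.ker) := congrArg Subtype.val hn₃
    linear_combination (norm := module) -hn₃'
  · change s (0, 1) + n₂ + (s (0, 1) + G n₁) = s 0 + n₀ + (s 0 + θ n₀)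
    linear_combination (norm := module) -hn₀
  · change s (1, 1) + (θ⁻¹ n₃ : π.ker) + (s 0 + θ n₀) = k + n₁ + (s (0, 1) + G n₁)
    linear_combination (norm := module) -hk

theorem IsSplittable.of_octo_quotient {π : K →+ ZMod 2 × ZMod 2 × ZMod 2}
    (hπ : Function.Surjective π) (hodd : Odd (Nat.card π.ker)) (h : IsSplittable π.ker) :
    IsSplittable K := by
  obtain ⟨⟨θ, hθ, hθall⟩, G, hG, n₁, n₂, hne, hcover⟩ := h
  obtain ⟨s, hs⟩ : ∃ s : ZMod 2 × ZMod 2 × ZMod 2 → K, ∀ q, π (s q) = q :=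
    ⟨Function.surjInv hπ, Function.surjInv_eq hπ⟩
  have hfibre {ψ : Equiv.Perm π.ker} (hψ : IsCompleteMapping ψ) (q : ZMod 2 × ZMod 2 × ZMod 2) :
      IsCompleteMapping (fibreMap octoPerm (1, 0, 0) θ ψ 1 q) := by
    simp only [fibreMap, Pi.one_apply, one_mul, inv_one, mul_one]
    split_ifs
    exacts [hθ, hψ, isCompleteMapping_one hodd]
  refine ⟨?_, isCyclicOffZero_octoPerm.exists_twoCycle isCompleteMapping_octoPerm hs (hfibre hθ)
    hθall⟩
  have hker : ∀ x : π.ker, π x = 0 := fun x => x.2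
  obtain ⟨n₀, hn₀⟩ := hθ.exists_add_eq (π := π)
    (x := s (0, 1, 0) + n₂ + (s (0, 1, 0) + G n₁) - (s 0 + s 0)) (by
      simp only [map_add, map_sub, hs, hker]; decide)
  obtain ⟨k, hk⟩ : ∃ k : K, k = s (1, 1, 0) + (s 0 + θ n₀) - (n₁ + (s (0, 1, 0) + G n₁)) :=
    ⟨_, rfl⟩
  obtain ⟨l, hl⟩ : ∃ l : K, l = k + n₁ + (s (0, 0, 1) + n₂) - s (1, 1, 0) := ⟨_, rfl⟩
  have hπk : π k = (1, 0, 0) := by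
    rw [hk]
    simp only [map_add, map_sub, hs, hker]
    decide
  have hπl : π l = (0, 1, 1) := by
    rw [hl]
    simp only [map_add, map_sub, hs, hker, hπk]
    decide
  refine isCyclicOffZero_octoPerm.exists_oneCycle isCompleteMapping_octoPerm
    (map_update_section (map_update_section hs hπk) hπl) (hfibre hG) hθall hne hcover
    (c := (1, 1, 0)) rfl rfl rfl (by decide) (by decide) (by decide) (by decide) (n₀ := n₀)
    (n₃ := 0) ?_ ?_ ?_
  · change k + n₁ + (s (0, 0, 1) + n₂) = s (1, 1, 0) + ((0 : π.ker) : K) + (l + ((0 : π.ker) : K))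
    rw [ZeroMemClass.coe_zero]
    linear_combination (norm := module) -hl
  · change s (0, 1, 0) + n₂ + (s (0, 1, 0) + G n₁) = s 0 + n₀ + (s 0 + θ n₀)
    linear_combination (norm := module) -hn₀
  · change s (1, 1, 0) + ((0 : π.ker) : K) + (s 0 + θ n₀) = k + n₁ + (s (0, 1, 0) + G n₁)
    rw [ZeroMemClass.coe_zero]
    linear_combination (norm := module) -hk

end KleinOcto

section Bases

theorem sameCycle_addRight_one {n : ℕ} (i j : Fin (n + 1)) :
    (Equiv.addRight (1 : Fin (n + 1))).SameCycle i j :=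
  sameCycle_addRight (K := ZMod (n + 1)) (g := (1 : ZMod (n + 1)))
    (fun k => AddSubgroup.mem_zmultiples_iff.2 ⟨k.val, by
      rw [natCast_zsmul, nsmul_one, ZMod.natCast_zmod_val]⟩) i j

section Sequences

variable {K : Type*} [AddCommGroup K] [Finite K] {n : ℕ}

theorem exists_oneCycle_of_sequence (hK : Nat.card K = n + 1) {c : Fin (n + 1) → K}
    (hc : Function.Injective c) (hc_sum : Function.Injective fun i => c i + c (i + 1)) :
    ∃ θ : Equiv.Perm K, IsCompleteMapping θ ∧ ∀ x y, θ.SameCycle x y := by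
  obtain ⟨e, rfl⟩ : ∃ e : Fin (n + 1) ≃ K, e = c :=
    ⟨.ofBijective c ((Nat.bijective_iff_injective_and_card c).2 ⟨hc, by simp [hK]⟩), rfl⟩
  refine ⟨e.permCongr (Equiv.addRight 1),
    Finite.injective_iff_bijective.1 ((e.injective_comp _).1 ?_),
    e.surjective.forall₂.2 fun i j => (sameCycle_permCongr e).2 (sameCycle_addRight_one i j)⟩
  simpa only [Function.comp_def, Equiv.permCongr_apply, Equiv.symm_apply_apply,
    Equiv.coe_addRight] using hc_sum

theorem exists_twoCycle_of_sequence (hK : Nat.card K = n + 2) {d : Fin (n + 1) → K}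
    (hd : Function.Injective d) (hd_sum : Function.Injective fun i => d i + d (i + 1))
    (hd₀ : ∀ i, d i ≠ 0) (hd₀_sum : ∀ i, d i + d (i + 1) ≠ 0) :
    ∃ θ : Equiv.Perm K, IsCompleteMapping θ ∧
      ∃ u v, ¬ θ.SameCycle u v ∧ ∀ x, θ.SameCycle u x ∨ θ.SameCycle v x := by
  classical
  obtain ⟨e, he⟩ : ∃ e : Fin (n + 1) ≃ {x : K // x ≠ 0}, ∀ i, (e i : K) = d i :=
    ⟨.ofBijective (fun i => ⟨d i, hd₀ i⟩) ((Nat.bijective_iff_injective_and_card _).2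
      ⟨fun i j h => hd (congrArg Subtype.val h), by
        have := Fintype.ofFinite K
        rw [Nat.card_eq_fintype_card] at hK
        simp [hK]⟩), fun _ => rfl⟩
  set θ := (Equiv.addRight (1 : Fin (n + 1))).extendDomain e with hθ
  have hθ₀ : θ 0 = 0 := Equiv.Perm.extendDomain_apply_not_subtype _ e (not_not.2 rfl)
  have hθd (i) : θ (d i) = d (i + 1) := by
    rw [← he, ← he, hθ, Equiv.Perm.extendDomain_apply_image, Equiv.coe_addRight]
  have hcases (x : K) : x = 0 ∨ ∃ i, d i = x := or_iff_not_imp_left.2 fun hx =>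
    ⟨e.symm ⟨x, hx⟩, by rw [← he, e.apply_symm_apply]⟩
  refine ⟨θ, Finite.injective_iff_bijective.1 fun x y hxy => ?_, 0, d 0, fun h => ?_, fun x => ?_⟩
  · rcases hcases x with rfl | ⟨i, rfl⟩ <;> rcases hcases y with rfl | ⟨j, rfl⟩ <;>
      simp only [hθ₀, hθd, add_zero] at hxy
    exacts [rfl, absurd hxy.symm (hd₀_sum j), absurd hxy (hd₀_sum i), congrArg d (hd_sum hxy)]
  · exact hd₀ 0 (mem_of_sameCycle (S := {0}) (fun x hx => by rw [hx]; exact hθ₀) h rfl)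
  · rcases hcases x with rfl | ⟨i, rfl⟩
    · exact .inl (.refl _ _)
    · rw [← he, ← he]
      exact .inr (Equiv.Perm.sameCycle_extendDomain.2 (sameCycle_addRight_one 0 i))

theorem isSplittable_of_sequences (hK : Nat.card K = n + 2) (c : Fin (n + 2) → K)
    (d : Fin (n + 1) → K) (hc : Function.Injective c)
    (hc_sum : Function.Injective fun i => c i + c (i + 1)) (hd : Function.Injective d)
    (hd_sum : Function.Injective fun i => d i + d (i + 1)) (hd₀ : ∀ i, d i ≠ 0)
    (hd₀_sum : ∀ i, d i + d (i + 1) ≠ 0) : IsSplittable K :=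
  ⟨exists_oneCycle_of_sequence hK hc hc_sum, exists_twoCycle_of_sequence hK hd hd_sum hd₀ hd₀_sum⟩

end Sequences

theorem isSplittable_zmod_four_four : IsSplittable (ZMod 4 × ZMod 4) :=
  isSplittable_of_sequences (n := 14) (by simp)
    ![(0, 0), (0, 3), (2, 2), (3, 3), (3, 0), (2, 3), (1, 2), (1, 0), (3, 2), (0, 2), (3, 1),
      (1, 3), (0, 1), (1, 1), (2, 1), (2, 0)]
    ![(0, 1), (0, 2), (3, 0), (2, 3), (3, 2), (3, 1), (1, 0), (1, 2), (2, 2), (0, 3), (2, 1),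
      (3, 3), (1, 3), (2, 0), (1, 1)]
    (by decide) (by decide) (by decide) (by decide) (by decide) (by decide)

theorem isSplittable_zmod_two_two_four : IsSplittable (ZMod 2 × ZMod 2 × ZMod 4) :=
  isSplittable_of_sequences (n := 14) (by simp)
    ![(0, 0, 0), (0, 1, 1), (0, 0, 3), (0, 1, 0), (0, 1, 3), (1, 0, 2), (0, 1, 2), (1, 1, 2),
      (1, 1, 0), (1, 1, 1), (0, 0, 1), (1, 0, 0), (0, 0, 2), (1, 0, 1), (1, 0, 3), (1, 1, 3)]
    ![(0, 0, 1), (0, 1, 3), (1, 1, 0), (0, 0, 3), (1, 1, 2), (1, 1, 1), (1, 0, 2), (1, 1, 3),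
      (0, 1, 1), (1, 0, 3), (0, 0, 2), (0, 1, 0), (0, 1, 2), (1, 0, 0), (1, 0, 1)]
    (by decide) (by decide) (by decide) (by decide) (by decide) (by decide)

theorem isSplittable_zmod_two_two_three : IsSplittable (ZMod 2 × ZMod 2 × ZMod 3) :=
  isSplittable_of_sequences (n := 10) (by simp)
    ![(0, 0, 0), (0, 0, 2), (1, 0, 1), (1, 0, 0), (1, 1, 0), (0, 1, 1), (1, 1, 1), (1, 1, 2),
      (0, 0, 1), (0, 1, 0), (1, 0, 2), (0, 1, 2)]
    ![(0, 0, 1), (1, 0, 1), (1, 1, 2), (0, 0, 2), (1, 1, 1), (0, 1, 2), (1, 0, 0), (1, 0, 2),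
      (1, 1, 0), (0, 1, 1), (0, 1, 0)]
    (by decide) (by decide) (by decide) (by decide) (by decide) (by decide)

theorem isSplittable_zmod_two_two_two_three : IsSplittable (ZMod 2 × ZMod 2 × ZMod 2 × ZMod 3) :=
  isSplittable_of_sequences (n := 22) (by simp)
    ![(0, 0, 0, 0), (1, 0, 0, 0), (0, 1, 0, 2), (1, 0, 0, 2), (0, 1, 1, 2), (0, 1, 0, 1),
      (1, 0, 1, 1), (1, 1, 1, 1), (0, 1, 1, 0), (1, 1, 1, 2), (1, 0, 0, 1), (1, 1, 0, 0),
      (0, 1, 1, 1), (0, 1, 0, 0), (0, 0, 1, 2), (0, 0, 1, 0), (0, 0, 1, 1), (0, 0, 0, 1),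
      (1, 0, 1, 2), (1, 1, 0, 2), (1, 1, 0, 1), (0, 0, 0, 2), (1, 0, 1, 0), (1, 1, 1, 0)]
    ![(0, 0, 0, 1), (0, 1, 0, 0), (0, 0, 0, 2), (1, 0, 0, 2), (0, 1, 1, 0), (0, 1, 1, 1),
      (1, 1, 0, 2), (1, 0, 1, 1), (0, 1, 0, 2), (1, 1, 0, 0), (1, 0, 0, 0), (0, 0, 1, 2),
      (1, 1, 1, 1), (1, 0, 0, 1), (1, 0, 1, 0), (1, 1, 0, 1), (0, 0, 1, 0), (1, 1, 1, 2),
      (1, 1, 1, 0), (0, 1, 0, 1), (0, 1, 1, 2), (1, 0, 1, 2), (0, 0, 1, 1)]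
    (by decide) (by decide) (by decide) (by decide) (by decide) (by decide)

theorem exists_twoCycle_of_finite_field {F : Type*} [Field F] [Finite F] (hF : 3 < Nat.card F) :
    ∃ G : Equiv.Perm F, IsCompleteMapping G ∧
      ∃ u v, ¬ G.SameCycle u v ∧ ∀ x, G.SameCycle u x ∨ G.SameCycle v x := by
  obtain ⟨g, hg⟩ := IsCyclic.exists_generator (α := Fˣ)
  have hg₁ : 1 + (g : F) ≠ 0 := fun h => by
    have hdvd : orderOf g ∣ 2 := orderOf_dvd_of_pow_eq_one (Units.ext (by
      push_cast
      linear_combination ((g : F) - 1) * h))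
    rw [orderOf_eq_card_of_forall_mem_zpowers hg, Nat.card_units] at hdvd
    have := Nat.le_of_dvd two_pos hdvd
    omega
  refine ⟨MulAction.toPermHom Fˣ F g, Finite.injective_iff_bijective.1 fun x y h => ?_, 0, 1,
    fun h => ?_, fun x => ?_⟩
  · have hxy : x + g * x = y + g * y := h
    exact mul_left_cancel₀ hg₁ (by linear_combination hxy)
  · exact one_ne_zero (mem_of_sameCycle (S := {0}) (by simp) h rfl)
  · rcases eq_or_ne x 0 with rfl | hx
    · exact .inl (.refl _ _)
    · obtain ⟨k, hk⟩ := hg (Units.mk0 x hx)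
      refine .inr ⟨k, ?_⟩
      rw [← map_zpow]
      simp [show g ^ k = _ from hk, Units.smul_def]

theorem isSplittable_zmod_prime (p : ℕ) [hp : Fact p.Prime] (hp5 : 5 ≤ p) :
    IsSplittable (ZMod p) := by
  have hodd : Odd (Nat.card (ZMod p)) := by
    rw [Nat.card_zmod]
    exact hp.out.odd_of_ne_two (by omega)
  exact ⟨⟨_, isCompleteMapping_addRight hodd 1,
    sameCycle_addRight fun x => AddSubgroup.mem_zmultiples_iff.2 ⟨x.val, by simp⟩⟩,
    exists_twoCycle_of_finite_field (by rw [Nat.card_zmod]; omega)⟩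

end Bases

section TwoProdFourMul

/-- Whether a residue modulo `4 * q` lies in the upper half `2 * q ≤ n < 4 * q`. -/
def upperBit (q : ℕ) (n : ZMod (4 * q)) : ZMod 2 := if n.val < 2 * q then 0 else 1

/-- The point `(n, b)` of `ZMod (4 * q) × ZMod 2`, indexed by a natural number `n`. -/
def gridPoint (q n : ℕ) (b : ZMod 2) : ZMod (4 * q) × ZMod 2 := (n, b)

variable {q : ℕ}

theorem gridPoint_ne {m n : ℕ} {a b : ZMod 2} (hm : m < 4 * q) (hn : n < 4 * q)
    (h : m ≠ n ∨ a ≠ b) : gridPoint q m a ≠ gridPoint q n b := by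
  rwa [gridPoint, gridPoint, Ne, Prod.mk.injEq, ZMod.natCast_eq_natCast_iff',
    Nat.mod_eq_of_lt hm, Nat.mod_eq_of_lt hn, not_and_or]

theorem gridPoint_add_gridPoint (m n : ℕ) (a b : ZMod 2) :
    gridPoint q m a + gridPoint q n b = gridPoint q (m + n) (a + b) := by
  rw [gridPoint, gridPoint, gridPoint, Prod.mk_add_mk, Nat.cast_add]

theorem gridPoint_add_four_mul (n : ℕ) (b : ZMod 2) :
    gridPoint q (n + 4 * q) b = gridPoint q n b := by
  rw [gridPoint, gridPoint, Nat.cast_add, ZMod.natCast_self, add_zero]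

theorem upperBit_of_lt {n : ℕ} (hn : n < 2 * q) : upperBit q n = 0 := by
  rw [upperBit, ZMod.val_natCast_of_lt (by omega), if_pos hn]

theorem upperBit_add {n : ℕ} (hn : n < 2 * q) : upperBit q (n + 2 * q : ℕ) = 1 := by
  rw [upperBit, ZMod.val_natCast_of_lt (by omega), if_neg (by omega)]

theorem natCast_add_two_mul_add_two_mul (n : ℕ) :
    ((n + 2 * q + 2 * q : ℕ) : ZMod (4 * q)) = n := by
  rw [show n + 2 * q + 2 * q = n + 4 * q by ring, Nat.cast_add, ZMod.natCast_self, add_zero]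

variable [NeZero q]

theorem exists_lt_eq_or_eq_add (x : ZMod (4 * q)) :
    ∃ n < 2 * q, x = n ∨ x = (n + 2 * q : ℕ) := by
  have hx := x.val_lt
  rcases lt_or_ge x.val (2 * q) with h | h
  · exact ⟨x.val, h, .inl (ZMod.natCast_zmod_val x).symm⟩
  · refine ⟨x.val - 2 * q, by omega, .inr ?_⟩
    rw [Nat.sub_add_cancel h, ZMod.natCast_zmod_val]

theorem upperBit_add_two_mul (x : ZMod (4 * q)) :
    upperBit q (x + (2 * q : ℕ)) = upperBit q x + 1 := by
  obtain ⟨n, hn, rfl | rfl⟩ := exists_lt_eq_or_eq_add x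
  · rw [← Nat.cast_add, upperBit_add hn, upperBit_of_lt hn, zero_add]
  · rw [← Nat.cast_add, natCast_add_two_mul_add_two_mul, upperBit_add hn, upperBit_of_lt hn]
    rfl

theorem eq_of_add_self_eq_of_upperBit_eq {x y : ZMod (4 * q)} (h : x + x = y + y)
    (hbit : upperBit q x = upperBit q y) : x = y := by
  have hneg : -(x - y) = x - y := by linear_combination -h
  rcases (ZMod.neg_eq_self_iff _).1 hneg with h₀ | h₀
  · exact sub_eq_zero.1 h₀
  · have hxy : x = y + (2 * q : ℕ) := by
      rw [← sub_eq_iff_eq_add', ← ZMod.natCast_zmod_val (x - y)]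
      congr 1
      omega
    rw [hxy, upperBit_add_two_mul] at hbit
    exact absurd hbit (by simp)

theorem add_self_add_one_ne (x y : ZMod (4 * q)) : x + x + 1 ≠ y + y + (2 * q : ℕ) := by
  intro h
  have hfour : (4 * q : ZMod (4 * q)) = 0 := by exact_mod_cast ZMod.natCast_self (4 * q)
  have htwo : ((2 * q : ℕ) : ZMod (4 * q)) = 0 := by
    push_cast at h ⊢
    linear_combination (2 * q : ZMod (4 * q)) * h + (y - x + q) * hfour
  have := Nat.le_of_dvd (by have := NeZero.pos q; omega) ((ZMod.natCast_eq_zero_iff _ _).1 htwo)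
  have := NeZero.pos q
  omega

/-- A short step `(n + 1, 0)` from the points `(n, upperBit q n)` and a long step `(n + 2 * q, 1)`
from the other points. -/
noncomputable def stepPerm (q : ℕ) [NeZero q] : Equiv.Perm (ZMod (4 * q) × ZMod 2) :=
  .ofBijective (fun x => if x.2 = upperBit q x.1 then (x.1 + 1, 0) else (x.1 + (2 * q : ℕ), 1)) <|
    Finite.injective_iff_bijective.1 fun ⟨m, a⟩ ⟨n, b⟩ h => by
      have hbit : ∀ {a b c : ZMod 2}, a ≠ c → b ≠ c → a = b := by decide
      simp only at h
      split_ifs at h with ha hb hb <;> simp only [Prod.mk.injEq, add_left_inj] at h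
      · rw [ha, hb, h.1]
      · exact absurd h.2 (by decide)
      · exact absurd h.2 (by decide)
      · obtain ⟨rfl, -⟩ := h
        rw [hbit ha hb]

theorem stepPerm_apply (n : ZMod (4 * q)) (b : ZMod 2) : stepPerm q (n, b) =
    if b = upperBit q n then (n + 1, 0) else (n + (2 * q : ℕ), 1) := rfl

theorem isCompleteMapping_stepPerm : IsCompleteMapping (stepPerm q) := by
  refine Finite.injective_iff_bijective.1 fun ⟨m, a⟩ ⟨n, b⟩ h => ?_
  have hbit : ∀ {a c : ZMod 2}, a ≠ c → a + 1 = c := by decide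
  simp only [stepPerm_apply] at h
  split_ifs at h with ha hb hb <;> simp only [Prod.mk_add_mk, Prod.mk.injEq, ← add_assoc] at h
  · rw [add_zero, add_zero, ha, hb] at h
    rw [ha, hb, eq_of_add_self_eq_of_upperBit_eq (add_right_cancel h.1) h.2]
  · exact absurd h.1 (add_self_add_one_ne m n)
  · exact absurd h.1.symm (add_self_add_one_ne n m)
  · rw [hbit ha, hbit hb, add_left_inj] at h
    obtain rfl := eq_of_add_self_eq_of_upperBit_eq h.1 h.2
    rw [add_right_cancel ((hbit ha).trans (hbit hb).symm)]

theorem stepPerm_lower_zero {n : ℕ} (hn : n < 2 * q) :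
    stepPerm q (gridPoint q n 0) = gridPoint q (n + 1) 0 := by
  rw [gridPoint, gridPoint, stepPerm_apply, upperBit_of_lt hn, if_pos rfl, Nat.cast_succ]

theorem stepPerm_lower_one {n : ℕ} (hn : n < 2 * q) :
    stepPerm q (gridPoint q n 1) = gridPoint q (n + 2 * q) 1 := by
  rw [gridPoint, gridPoint, stepPerm_apply, upperBit_of_lt hn, if_neg one_ne_zero, Nat.cast_add]

theorem stepPerm_upper_zero {n : ℕ} (hn : n < 2 * q) :
    stepPerm q (gridPoint q (n + 2 * q) 0) = gridPoint q n 1 := by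
  rw [gridPoint, gridPoint, stepPerm_apply, upperBit_add hn, if_neg zero_ne_one, ← Nat.cast_add,
    natCast_add_two_mul_add_two_mul]

theorem stepPerm_upper_one {n : ℕ} (hn : n < 2 * q) :
    stepPerm q (gridPoint q (n + 2 * q) 1) = gridPoint q (n + 2 * q + 1) 0 := by
  rw [gridPoint, gridPoint, stepPerm_apply, upperBit_add hn, if_pos rfl, Nat.cast_succ]

theorem exists_gridPoint_eq (x : ZMod (4 * q) × ZMod 2) :
    ∃ n < 2 * q, (x = gridPoint q n 0 ∨ x = gridPoint q n 1) ∨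
      x = gridPoint q (n + 2 * q) 0 ∨ x = gridPoint q (n + 2 * q) 1 := by
  have hbit : ∀ b : ZMod 2, b = 0 ∨ b = 1 := by decide
  obtain ⟨n, hn, h⟩ := exists_lt_eq_or_eq_add x.1
  exact ⟨n, hn, h.imp (fun h => (hbit x.2).imp (Prod.ext h) (Prod.ext h))
    (fun h => (hbit x.2).imp (Prod.ext h) (Prod.ext h))⟩

theorem sameCycle_stepPerm (x y : ZMod (4 * q) × ZMod 2) : (stepPerm q).SameCycle x y := by
  have hcolumn {n : ℕ} (hn : n < 2 * q)
      (h : (stepPerm q).SameCycle (gridPoint q 0 0) (gridPoint q (n + 2 * q) 0)) :=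
    have h₁ := sameCycle_of_apply_eq (stepPerm_upper_zero hn) h
    And.intro h₁ (sameCycle_of_apply_eq (stepPerm_lower_one hn) h₁)
  have hrow : ∀ n ≤ 4 * q, (stepPerm q).SameCycle (gridPoint q 0 0) (gridPoint q n 0) := by
    intro n
    induction n with
    | zero => exact fun _ => .refl _ _
    | succ n ih =>
      intro hn
      rcases lt_or_ge n (2 * q) with h | h
      · exact sameCycle_of_apply_eq (stepPerm_lower_zero h) (ih (by omega))
      · obtain ⟨n, rfl⟩ := Nat.exists_eq_add_of_le' h
        exact sameCycle_of_apply_eq (stepPerm_upper_one (by omega))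
          (hcolumn (by omega) (ih (by omega))).2
  have hall (x) : (stepPerm q).SameCycle (gridPoint q 0 0) x := by
    obtain ⟨n, hn, (rfl | rfl) | rfl | rfl⟩ := exists_gridPoint_eq x
    exacts [hrow _ (by omega), (hcolumn hn (hrow _ (by omega))).1, hrow _ (by omega),
      (hcolumn hn (hrow _ (by omega))).2]
  exact (hall x).symm.trans (hall y)

/-- The points at which `stepPerm q` is modified to split off a fixed point. -/
def tradeNode (q : ℕ) [NeZero q] : Fin 5 ↪ ZMod (4 * q) × ZMod 2 where
  toFun := ![gridPoint q 0 1, gridPoint q (2 * q - 1 + 2 * q) 1, gridPoint q (2 * q - 1) 0,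
    gridPoint q (q - 1 + 2 * q) 1, gridPoint q (q + 2 * q) 0]
  inj' i j h := by
    have hq := NeZero.pos q
    fin_cases i <;> fin_cases j <;> try rfl
    all_goals
      refine absurd h (gridPoint_ne (by omega) (by omega) ?_)
      first
      | exact .inr (by decide)
      | exact .inl (by omega)

theorem stepPerm_tradeNode (i : Fin 5) : stepPerm q (tradeNode q i) =
    ![gridPoint q (2 * q) 1, gridPoint q 0 0, gridPoint q (2 * q) 0, gridPoint q (3 * q) 0,
      gridPoint q q 1] i := by
  have hq := NeZero.pos q
  fin_cases i
  · exact (stepPerm_lower_one (by omega)).trans (by rw [zero_add]; rfl)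
  · refine (stepPerm_upper_one (by omega)).trans ?_
    rw [show 2 * q - 1 + 2 * q + 1 = 0 + 4 * q by omega]
    exact gridPoint_add_four_mul 0 0
  · refine (stepPerm_lower_zero (by omega)).trans ?_
    rw [Nat.sub_add_cancel (by omega)]
    rfl
  · refine (stepPerm_upper_one (by omega)).trans ?_
    rw [show q - 1 + 2 * q + 1 = 3 * q by omega]
    rfl
  · exact stepPerm_upper_zero (by omega)

/-- The modification of `stepPerm q` at the points `tradeNode q` which fixes the last of them. -/
noncomputable def tradePerm (q : ℕ) [NeZero q] : Equiv.Perm (ZMod (4 * q) × ZMod 2) :=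
  stepPerm q * Equiv.Perm.viaEmbedding (c[0, 1, 2] * c[3, 4]) (tradeNode q)

theorem isCompleteMapping_tradePerm : IsCompleteMapping (tradePerm q) := by
  have hq := NeZero.pos q
  refine isCompleteMapping_stepPerm.mul_viaEmbedding (tradeNode q) (π := c[0, 4] * c[2, 1, 3])
    fun i => ?_
  rw [stepPerm_tradeNode, stepPerm_tradeNode]
  fin_cases i
  · change gridPoint q 0 1 + gridPoint q 0 0 = gridPoint q (q + 2 * q) 0 + gridPoint q q 1
    rw [gridPoint_add_gridPoint, gridPoint_add_gridPoint, show q + 2 * q + q = 0 + 4 * q by omega,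
      gridPoint_add_four_mul]
    rfl
  · change gridPoint q (2 * q - 1 + 2 * q) 1 + gridPoint q (2 * q) 0 =
      gridPoint q (q - 1 + 2 * q) 1 + gridPoint q (3 * q) 0
    rw [gridPoint_add_gridPoint, gridPoint_add_gridPoint]
    congr 1
    omega
  · change gridPoint q (2 * q - 1) 0 + gridPoint q (2 * q) 1 =
      gridPoint q (2 * q - 1 + 2 * q) 1 + gridPoint q 0 0
    rw [gridPoint_add_gridPoint, gridPoint_add_gridPoint]
    rfl
  · change gridPoint q (q - 1 + 2 * q) 1 + gridPoint q q 1 =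
      gridPoint q (2 * q - 1) 0 + gridPoint q (2 * q) 0
    rw [gridPoint_add_gridPoint, gridPoint_add_gridPoint]
    congr 1
    omega
  · change gridPoint q (q + 2 * q) 0 + gridPoint q (3 * q) 0 =
      gridPoint q 0 1 + gridPoint q (2 * q) 1
    rw [gridPoint_add_gridPoint, gridPoint_add_gridPoint,
      show q + 2 * q + 3 * q = 0 + 2 * q + 4 * q by omega, gridPoint_add_four_mul]
    rfl

theorem tradePerm_tradeNode (i : Fin 5) : tradePerm q (tradeNode q i) =
    ![gridPoint q 0 0, gridPoint q (2 * q) 0, gridPoint q (2 * q) 1, gridPoint q q 1,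
      gridPoint q (3 * q) 0] i := by
  rw [tradePerm, Equiv.Perm.mul_apply, Equiv.Perm.viaEmbedding_apply, stepPerm_tradeNode]
  fin_cases i <;> rfl

theorem tradePerm_gridPoint_zero {n : ℕ} (hn : n < 4 * q) (hc : n ≠ 2 * q - 1)
    (he : n ≠ q + 2 * q) : tradePerm q (gridPoint q n 0) = stepPerm q (gridPoint q n 0) := by
  rw [tradePerm, Equiv.Perm.mul_apply, Equiv.Perm.viaEmbedding_apply_of_notMem]
  rintro ⟨i, hi⟩
  have hq := NeZero.pos q
  fin_cases i <;> refine gridPoint_ne (by omega) hn ?_ hi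
  exacts [.inr (by decide), .inr (by decide), .inl hc.symm, .inr (by decide), .inl he.symm]

theorem tradePerm_gridPoint_one {n : ℕ} (hn : n < 4 * q) (ha : n ≠ 0) (hb : n ≠ 2 * q - 1 + 2 * q)
    (hd : n ≠ q - 1 + 2 * q) : tradePerm q (gridPoint q n 1) = stepPerm q (gridPoint q n 1) := by
  rw [tradePerm, Equiv.Perm.mul_apply, Equiv.Perm.viaEmbedding_apply_of_notMem]
  rintro ⟨i, hi⟩
  have hq := NeZero.pos q
  fin_cases i <;> refine gridPoint_ne (by omega) hn ?_ hi
  exacts [.inl ha.symm, .inl hb.symm, .inr (by decide), .inl hd.symm, .inr (by decide)]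

theorem sameCycle_tradePerm_lower_zero {n : ℕ} (hn : n < 2 * q) :
    (tradePerm q).SameCycle (gridPoint q 0 0) (gridPoint q n 0) := by
  induction n with
  | zero => exact .refl _ _
  | succ n ih =>
    exact sameCycle_of_apply_eq
      ((tradePerm_gridPoint_zero (by omega) (by omega) (by omega)).trans
        (stepPerm_lower_zero (by omega))) (ih (by omega))

theorem sameCycle_tradePerm_upper_zero_succ {n : ℕ} (hn : n + 1 < 2 * q) (hd : n + 1 ≠ q)
    (h : (tradePerm q).SameCycle (gridPoint q 0 0) (gridPoint q (n + 2 * q) 1)) :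
    (tradePerm q).SameCycle (gridPoint q 0 0) (gridPoint q (n + 1 + 2 * q) 0) := by
  refine sameCycle_of_apply_eq ?_ h
  rw [tradePerm_gridPoint_one (by omega) (by omega) (by omega) (by omega),
    stepPerm_upper_one (by omega), Nat.add_right_comm]

theorem sameCycle_tradePerm_lower_one_succ {n : ℕ} (hn : n + 1 < 2 * q)
    (h : (tradePerm q).SameCycle (gridPoint q 0 0) (gridPoint q (n + 2 * q) 1)) :
    (tradePerm q).SameCycle (gridPoint q 0 0) (gridPoint q (n + 1) 1) := by
  rcases eq_or_ne (n + 1) q with hd | hd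
  · obtain rfl : n = q - 1 := by omega
    rw [hd]
    exact sameCycle_of_apply_eq (tradePerm_tradeNode 3) h
  · exact sameCycle_of_apply_eq
      ((tradePerm_gridPoint_zero (by omega) (by omega) (by omega)).trans
        (stepPerm_upper_zero hn)) (sameCycle_tradePerm_upper_zero_succ hn hd h)

theorem sameCycle_tradePerm_upper_one {n : ℕ} (hn : n < 2 * q) :
    (tradePerm q).SameCycle (gridPoint q 0 0) (gridPoint q (n + 2 * q) 1) := by
  induction n with
  | zero =>
    rw [zero_add]
    exact sameCycle_of_apply_eq (tradePerm_tradeNode 2)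
      (sameCycle_tradePerm_lower_zero (by omega))
  | succ n ih =>
    exact sameCycle_of_apply_eq
      ((tradePerm_gridPoint_one (by omega) (by omega) (by omega) (by omega)).trans
        (stepPerm_lower_one hn)) (sameCycle_tradePerm_lower_one_succ hn (ih (by omega)))

theorem tradePerm_fixed : tradePerm q (gridPoint q (q + 2 * q) 0) = gridPoint q (q + 2 * q) 0 :=
  (tradePerm_tradeNode 4).trans (by rw [show q + 2 * q = 3 * q by omega]; rfl)

theorem sameCycle_tradePerm {x : ZMod (4 * q) × ZMod 2} (hx : x ≠ gridPoint q (q + 2 * q) 0) :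
    (tradePerm q).SameCycle (gridPoint q 0 0) x := by
  have hq := NeZero.pos q
  have hcorner : (tradePerm q).SameCycle (gridPoint q 0 0) (gridPoint q (0 + 2 * q) 0) := by
    rw [zero_add]
    exact sameCycle_of_apply_eq (tradePerm_tradeNode 1)
      (sameCycle_tradePerm_upper_one (by omega))
  obtain ⟨n, hn, (rfl | rfl) | rfl | rfl⟩ := exists_gridPoint_eq x
  · exact sameCycle_tradePerm_lower_zero hn
  · cases n with
    | zero =>
      exact sameCycle_of_apply_eq
        ((tradePerm_gridPoint_zero (by omega) (by omega) (by omega)).trans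
          (stepPerm_upper_zero hn)) hcorner
    | succ n =>
      exact sameCycle_tradePerm_lower_one_succ hn (sameCycle_tradePerm_upper_one (by omega))
  · cases n with
    | zero => exact hcorner
    | succ n =>
      exact sameCycle_tradePerm_upper_zero_succ hn (fun h => hx (by rw [h]))
        (sameCycle_tradePerm_upper_one (by omega))
  · exact sameCycle_tradePerm_upper_one hn

theorem isSplittable_zmod_four_mul_two (q : ℕ) [NeZero q] :
    IsSplittable (ZMod (4 * q) × ZMod 2) := by
  refine ⟨⟨_, isCompleteMapping_stepPerm, sameCycle_stepPerm⟩,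
    _, isCompleteMapping_tradePerm, gridPoint q (q + 2 * q) 0, gridPoint q 0 0, fun h => ?_,
    fun x => ?_⟩
  · have hq := NeZero.pos q
    have hfixed := mem_of_sameCycle (S := {gridPoint q (q + 2 * q) 0})
      (by rintro _ rfl; exact tradePerm_fixed) h rfl
    exact gridPoint_ne (by omega) (by omega) (.inl (by omega)) hfixed
  · rcases eq_or_ne x (gridPoint q (q + 2 * q) 0) with rfl | hx
    · exact .inl (.refl _ _)
    · exact .inr (sameCycle_tradePerm hx)

end TwoProdFourMul

section Products

theorem exists_kerEquiv_of_exact {K L Q : Type*} [AddCommGroup K] [AddCommGroup L] [AddCommGroup Q]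
    {i : L →+ K} {π : K →+ Q} (hi : Function.Injective i) (hexact : Function.Exact i π) :
    Nonempty (L ≃+ π.ker) :=
  ⟨(AddMonoidHom.ofInjective hi).trans
    (AddEquiv.addSubgroupCongr (AddMonoidHom.exact_iff.1 hexact).symm)⟩

theorem exact_inr_fst (A B : Type*) [AddCommGroup A] [AddCommGroup B] :
    Function.Exact (AddMonoidHom.inr A B) (AddMonoidHom.fst A B) := fun x =>
  ⟨fun hx => ⟨x.2, Prod.ext hx.symm rfl⟩, by rintro ⟨b, rfl⟩; rfl⟩

theorem IsSplittable.of_exact_klein {K L : Type*} [AddCommGroup K] [Finite K] [AddCommGroup L]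
    {i : L →+ K} {π : K →+ ZMod 2 × ZMod 2} (hi : Function.Injective i)
    (hexact : Function.Exact i π) (hπ : Function.Surjective π) (h : IsSplittable L) :
    IsSplittable K :=
  have ⟨e⟩ := exists_kerEquiv_of_exact hi hexact
  .of_klein_quotient hπ (h.of_addEquiv e)

theorem IsSplittable.klein_prod {M : Type*} [AddCommGroup M] [Finite M] (h : IsSplittable M) :
    IsSplittable ((ZMod 2 × ZMod 2) × M) :=
  .of_exact_klein (Prod.mk_right_injective 0) (exact_inr_fst _ _) Prod.fst_surjective h

theorem IsSplittable.octo_prod {M : Type*} [AddCommGroup M] [Finite M] (hodd : Odd (Nat.card M))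
    (h : IsSplittable M) : IsSplittable ((ZMod 2 × ZMod 2 × ZMod 2) × M) := by
  obtain ⟨e⟩ := exists_kerEquiv_of_exact (Prod.mk_right_injective 0)
    (exact_inr_fst (ZMod 2 × ZMod 2 × ZMod 2) M)
  exact .of_octo_quotient Prod.fst_surjective (Nat.card_congr e.toEquiv ▸ hodd) (h.of_addEquiv e)

end Products

section OddFactor

theorem exists_addEquiv_of_elementary {E : Type*} [AddCommGroup E] [Finite E]
    (hE : ∀ x : E, x + x = 0) : ∃ r, Nonempty (E ≃+ (Fin r → ZMod 2)) := by
  let := AddCommGroup.zmodModule (n := 2) (G := E) fun x => by rw [two_nsmul, hE]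
  exact ⟨_, ⟨(Module.finBasis (ZMod 2) E).equivFun.toAddEquiv⟩⟩

theorem three_or_five_le {p : ℕ} (hp : p.Prime) (hp₂ : p ≠ 2) : p = 3 ∨ 5 ≤ p := by
  have := hp.two_le
  have : p ≠ 4 := by rintro rfl; exact absurd hp (by decide)
  omega

/-- The first coordinate of a vector, split off. -/
def piFinSuccAddEquiv (A : Type*) [AddCommGroup A] (r : ℕ) : (Fin (r + 1) → A) ≃+ A × (Fin r → A) :=
  (Fin.consLinearEquiv ℤ fun _ => A).symm.toAddEquiv

theorem isSplittable_pi_two_prod_prime {p : ℕ} [hp : Fact p.Prime] (hp₂ : p ≠ 2) :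
    ∀ r, IsSplittable ((Fin (r + 2) → ZMod 2) × ZMod p)
  | 0 => by
    have e := (RingEquiv.piFinTwo fun _ => ZMod 2).toAddEquiv
    refine .of_addEquiv (e.symm.prodCongr (.refl _)) ?_
    rcases three_or_five_le hp.out hp₂ with rfl | hp₅
    · exact isSplittable_zmod_two_two_three.of_addEquiv AddEquiv.prodAssoc.symm
    · exact (isSplittable_zmod_prime p hp₅).klein_prod
  | 1 => by
    have e : (Fin 3 → ZMod 2) ≃+ ZMod 2 × ZMod 2 × ZMod 2 := (piFinSuccAddEquiv _ 2).trans
      (.prodCongr (.refl _) (RingEquiv.piFinTwo fun _ => ZMod 2).toAddEquiv)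
    refine .of_addEquiv (e.symm.prodCongr (.refl _)) ?_
    rcases three_or_five_le hp.out hp₂ with rfl | hp₅
    · exact isSplittable_zmod_two_two_two_three.of_addEquiv
        (AddEquiv.prodAssoc.trans (.prodCongr (.refl _) .prodAssoc)).symm
    · exact (isSplittable_zmod_prime p hp₅).octo_prod
        (by rw [Nat.card_zmod]; exact hp.out.odd_of_ne_two hp₂)
  | r + 2 => by
    have e : (Fin (r + 4) → ZMod 2) ≃+ (ZMod 2 × ZMod 2) × (Fin (r + 2) → ZMod 2) :=
      (piFinSuccAddEquiv _ _).trans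
        ((AddEquiv.prodCongr (.refl _) (piFinSuccAddEquiv _ _)).trans AddEquiv.prodAssoc.symm)
    exact (isSplittable_pi_two_prod_prime hp₂ r).klein_prod.of_addEquiv
      (AddEquiv.prodAssoc.symm.trans (e.symm.prodCongr (.refl _)))

theorem injOn_mk_of_odd_card {K : Type*} [AddCommGroup K] {N : AddSubgroup K} [Finite N]
    (hN : Odd (Nat.card N)) : Set.InjOn (QuotientAddGroup.mk' N) {x | x + x = 0} := by
  intro x (hx : x + x = 0) y (hy : y + y = 0) hxy
  have hmem : -x + y ∈ N := QuotientAddGroup.eq.1 hxy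
  have hzero : (⟨-x + y, hmem⟩ : N) = 0 := addSelf_injective_of_odd_card hN <| Subtype.ext <| by
    change -x + y + (-x + y) = 0 + 0
    linear_combination (norm := module) hy - hx
  exact neg_add_eq_zero.1 (congrArg Subtype.val hzero)

theorem exists_addEquiv_quotient_prod {K : Type*} [AddCommGroup K] [Finite K] {N : AddSubgroup K}
    (hN : Odd (Nat.card N)) (hdouble : ∀ x, x + x ∈ N) : Nonempty (K ≃+ (K ⧸ N) × N) := by
  let double : K →+ N := (AddMonoidHom.id K + AddMonoidHom.id K).codRestrict N hdouble
  have hinj : Function.Injective ((QuotientAddGroup.mk' N).prod double) :=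
    (injective_iff_map_eq_zero _).2 fun x hx =>
      injOn_mk_of_odd_card hN (congrArg (Subtype.val ∘ Prod.snd) hx) (add_zero 0)
        ((congrArg Prod.fst hx).trans (map_zero _).symm)
  refine ⟨.ofBijective _ ((Nat.bijective_iff_injective_and_card _).2 ⟨hinj, ?_⟩)⟩
  rw [Nat.card_prod, ← AddSubgroup.card_eq_card_quotient_mul_card_addSubgroup]

theorem isSplittable_of_add_self_mem {K : Type*} [AddCommGroup K] [Finite K] {N : AddSubgroup K}
    {p : ℕ} [hp : Fact p.Prime] (hp₂ : p ≠ 2) (hN : Nat.card N = p) (hdouble : ∀ x, x + x ∈ N)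
    (hcard : 2 < Nat.card (K ⧸ N)) : IsSplittable K := by
  obtain ⟨e⟩ := exists_addEquiv_quotient_prod (hN ▸ hp.out.odd_of_ne_two hp₂) hdouble
  have hcyclic : IsAddCyclic N := isAddCyclic_of_prime_card hN
  have f : N ≃+ ZMod p := ((zmodAddCyclicAddEquiv hcyclic).symm.trans
    (ZMod.ringEquivCongr hN).toAddEquiv)
  obtain ⟨r, ⟨g⟩⟩ := exists_addEquiv_of_elementary (E := K ⧸ N) fun x => by
    obtain ⟨x, rfl⟩ := QuotientAddGroup.mk_surjective x
    exact (QuotientAddGroup.eq_zero_iff _).2 (hdouble x)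
  obtain ⟨r, rfl⟩ : ∃ s, r = s + 2 := by
    refine Nat.exists_eq_add_of_le' (Nat.le_of_not_lt fun hr => ?_)
    rw [Nat.card_congr g.toEquiv] at hcard
    interval_cases r <;> simp at hcard
  exact (isSplittable_pi_two_prod_prime hp₂ r).of_addEquiv (e.trans (g.prodCongr f)).symm

end OddFactor

section TwoGroup

theorem castHom_eq_zero_iff_dvd_val {c n : ℕ} [NeZero n] (hc : c ∣ n) (x : ZMod n) :
    ZMod.castHom hc (ZMod c) x = 0 ↔ c ∣ x.val := by
  rw [ZMod.castHom_apply, ZMod.cast_eq_val, ZMod.natCast_eq_zero_iff]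

theorem exists_zmod_scaleHom {a b c : ℕ} [NeZero b] (hb : b = c * a) :
    ∃ φ : ZMod a →+ ZMod b, Function.Injective φ ∧ ∀ y, y ∈ φ.range ↔ c ∣ y.val := by
  subst hb
  have hc : (c : ℤ) ≠ 0 := by exact_mod_cast left_ne_zero_of_mul (NeZero.ne (c * a))
  have hca : zmultiplesHom _ (c : ZMod (c * a)) a = 0 := by
    rw [zmultiplesHom_apply, natCast_zsmul, nsmul_eq_mul, mul_comm, ← Nat.cast_mul,
      ZMod.natCast_self]
  refine ⟨ZMod.lift a ⟨zmultiplesHom _ (c : ZMod (c * a)), hca⟩, ?_, fun y => ⟨?_, ?_⟩⟩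
  · refine (ZMod.lift_injective _).2 fun k hk => ?_
    have hk : ((c * k : ℤ) : ZMod (c * a)) = 0 := by
      simpa [zsmul_eq_mul, mul_comm] using hk
    rw [ZMod.intCast_zmod_eq_zero_iff_dvd, Nat.cast_mul] at hk
    exact (ZMod.intCast_zmod_eq_zero_iff_dvd _ _).2 ((mul_dvd_mul_iff_left hc).1 hk)
  · rintro ⟨x, rfl⟩
    obtain ⟨k, rfl⟩ := ZMod.intCast_surjective x
    rw [← castHom_eq_zero_iff_dvd_val (dvd_mul_right c a), ZMod.lift_coe]
    simp
  · rintro ⟨t, ht⟩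
    refine ⟨((t : ℤ) : ZMod a), ?_⟩
    rw [ZMod.lift_coe, ← ZMod.natCast_zmod_val y, ht]
    simp [mul_comm]

variable {ι : Type*}

/-- The reduction of two coordinates modulo `2`. -/
def parityHom {n : ι → ℕ} {i j : ι} (hi : 2 ∣ n i) (hj : 2 ∣ n j) :
    (∀ l, ZMod (n l)) →+ ZMod 2 × ZMod 2 :=
  ((ZMod.castHom hi (ZMod 2)).toAddMonoidHom.comp (Pi.evalAddMonoidHom _ i)).prod
    ((ZMod.castHom hj (ZMod 2)).toAddMonoidHom.comp (Pi.evalAddMonoidHom _ j))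

theorem parityHom_surjective {n : ι → ℕ} {i j : ι} (hij : i ≠ j) (hi : 2 ∣ n i) (hj : 2 ∣ n j) :
    Function.Surjective (parityHom hi hj) := by
  classical
  rintro ⟨a, b⟩
  refine ⟨Function.update (Function.update 0 i (a.val : ZMod (n i))) j b.val, Prod.ext ?_ ?_⟩ <;>
    simp [parityHom, hij]

theorem IsSplittable.pi_zmod_double [Finite ι] {n n' : ι → ℕ} [∀ l, NeZero (n' l)] {i j : ι}
    (hij : i ≠ j) (hi : n' i = 2 * n i) (hj : n' j = 2 * n j)
    (hn : ∀ l, l ≠ i → l ≠ j → n' l = n l) (h : IsSplittable (∀ l, ZMod (n l))) :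
    IsSplittable (∀ l, ZMod (n' l)) := by
  classical
  have hscale (l) : ∃ φ : ZMod (n l) →+ ZMod (n' l), Function.Injective φ ∧
      ∀ y, y ∈ φ.range ↔ ((l = i ∨ l = j) → 2 ∣ y.val) := by
    by_cases hl : l = i ∨ l = j
    · have hl₂ : n' l = 2 * n l := by rcases hl with rfl | rfl <;> assumption
      simpa only [hl, true_imp_iff] using exists_zmod_scaleHom hl₂
    · have hl₁ : n' l = 1 * n l := by
        rw [not_or] at hl
        rw [hn l hl.1 hl.2, one_mul]
      simpa only [hl, false_imp_iff, one_dvd] using exists_zmod_scaleHom hl₁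
  choose φ hφ hφ_range using hscale
  refine .of_exact_klein (i := AddMonoidHom.mk' (fun x l => φ l (x l)) fun x y => ?_)
    (π := parityHom ⟨n i, hi⟩ ⟨n j, hj⟩) ?_ (fun y => ?_) (parityHom_surjective hij _ _) h
  · funext l
    exact map_add _ _ _
  · exact Function.Injective.piMap hφ
  · have hker : parityHom ⟨n i, hi⟩ ⟨n j, hj⟩ y = 0 ↔ 2 ∣ (y i).val ∧ 2 ∣ (y j).val := by
      rw [← castHom_eq_zero_iff_dvd_val ⟨n i, hi⟩, ← castHom_eq_zero_iff_dvd_val ⟨n j, hj⟩]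
      exact Prod.ext_iff
    rw [hker]
    constructor
    · rintro ⟨hyi, hyj⟩
      choose x hx using fun l => (hφ_range l (y l)).2 (by rintro (rfl | rfl) <;> assumption)
      exact ⟨x, funext hx⟩
    · rintro ⟨x, rfl⟩
      exact ⟨(hφ_range i _).1 ⟨x i, rfl⟩ (.inl rfl), (hφ_range j _).1 ⟨x j, rfl⟩ (.inr rfl)⟩

/-- The exponents `e`, with those of the coordinates `j` and `k` lowered by one. -/
def lowerPair [DecidableEq ι] (e : ι → ℕ) (j k l : ι) : ℕ :=
  if l = j ∨ l = k then e l - 1 else e l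

theorem lowerPair_of_ne [DecidableEq ι] {e : ι → ℕ} {j k l : ι} (hj : l ≠ j) (hk : l ≠ k) :
    lowerPair e j k l = e l :=
  if_neg (not_or.2 ⟨hj, hk⟩)

theorem sub_one_le_lowerPair [DecidableEq ι] (e : ι → ℕ) (j k l : ι) :
    e l - 1 ≤ lowerPair e j k l := by
  unfold lowerPair
  split_ifs <;> omega

theorem IsSplittable.pi_two_pow_of_lowerPair [Finite ι] [DecidableEq ι] {e : ι → ℕ} {j k : ι}
    (hjk : j ≠ k) (hj : 1 ≤ e j) (hk : 1 ≤ e k)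
    (h : IsSplittable (∀ l, ZMod (2 ^ lowerPair e j k l))) :
    IsSplittable (∀ l, ZMod (2 ^ e l)) := by
  refine h.pi_zmod_double hjk ?_ ?_ fun l hlj hlk => by rw [lowerPair_of_ne hlj hlk]
  · rw [lowerPair, if_pos (.inl rfl), ← pow_succ', Nat.sub_add_cancel hj]
  · rw [lowerPair, if_pos (.inr rfl), ← pow_succ', Nat.sub_add_cancel hk]

theorem sum_lowerPair_lt [Fintype ι] [DecidableEq ι] {e : ι → ℕ} {j : ι} (k : ι) (hj : 1 ≤ e j) :
    ∑ l, lowerPair e j k l < ∑ l, e l := by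
  refine Finset.sum_lt_sum (fun l _ => ?_) ⟨j, Finset.mem_univ j, ?_⟩
  · unfold lowerPair
    split_ifs <;> omega
  · rw [lowerPair, if_pos (.inl rfl)]
    omega

/-- The exponents `e` of a product of cyclic `2`-groups with at least two nontrivial factors, one
of them of order at least four. -/
def IsAmpleExponents (e : ι → ℕ) : Prop :=
  ∃ i m, i ≠ m ∧ 1 ≤ e i ∧ 2 ≤ e m

/-- The ample exponents that cannot be lowered: those of `ZMod 2 × ZMod (2 ^ k)`,
`ZMod 4 × ZMod 4` and `ZMod 2 × ZMod 2 × ZMod 4`. -/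
def IsMinimalExponents (e : ι → ℕ) : Prop :=
  (∃ i m, i ≠ m ∧ (∀ l, l = i ∨ l = m ∨ e l = 0) ∧ 2 ≤ e m ∧ (e i = 1 ∨ e i = 2 ∧ e m = 2)) ∨
    ∃ i j m, i ≠ j ∧ i ≠ m ∧ j ≠ m ∧ (∀ l, l = i ∨ l = j ∨ l = m ∨ e l = 0) ∧
      e i = 1 ∧ e j = 1 ∧ e m = 2

theorem IsAmpleExponents.exists_lowerPair [DecidableEq ι] {e : ι → ℕ} (he : IsAmpleExponents e)
    (hmin : ¬ IsMinimalExponents e) :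
    ∃ j k, j ≠ k ∧ 1 ≤ e j ∧ 1 ≤ e k ∧ IsAmpleExponents (lowerPair e j k) := by
  obtain ⟨i, m, him, hi, hm⟩ := he
  have hlower (j k : ι) := sub_one_le_lowerPair e j k
  by_cases hthird : ∃ j, j ≠ i ∧ j ≠ m ∧ 1 ≤ e j
  · obtain ⟨j, hji, hjm, hj⟩ := hthird
    by_cases hfourth : ∃ k, k ≠ i ∧ k ≠ m ∧ k ≠ j ∧ 1 ≤ e k
    · obtain ⟨k, hki, hkm, hkj, hk⟩ := hfourth
      refine ⟨j, k, hkj.symm, hj, hk, i, m, him, ?_, ?_⟩ <;>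
        rwa [lowerPair_of_ne (Ne.symm ‹_›) (Ne.symm ‹_›)]
    have hjoin : lowerPair e i m j = e j := lowerPair_of_ne hji hjm
    have hm_fixed : lowerPair e i j m = e m := lowerPair_of_ne him.symm hjm.symm
    rcases (show 2 ≤ e i ∨ 2 ≤ e j ∨ 3 ≤ e m ∨ (e i = 1 ∧ e j = 1 ∧ e m = 2) by omega) with
      hi₂ | hj₂ | hm₃ | hbase
    · have := hlower i j i
      exact ⟨i, j, hji.symm, hi, hj, i, m, him, by omega, by omega⟩
    · have := hlower i j j
      exact ⟨i, j, hji.symm, hi, hj, j, m, hjm, by omega, by omega⟩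
    · have := hlower i m m
      exact ⟨i, m, him, hi, by omega, j, m, hjm, by omega, by omega⟩
    · exact absurd (.inr ⟨i, j, m, hji.symm, him, hjm, by grind, hbase⟩) hmin
  · have hrest (l) : l = i ∨ l = m ∨ e l = 0 := by grind
    have := hlower i m i
    have := hlower i m m
    rcases (show e i = 1 ∨ (e i = 2 ∧ e m = 2) ∨ (2 ≤ e i ∧ 3 ≤ e m) ∨ 3 ≤ e i by omega) with
      hi₁ | hbase | hm₃ | hi₃
    · exact absurd (.inl ⟨i, m, him, hrest, hm, .inl hi₁⟩) hmin
    · exact absurd (.inl ⟨i, m, him, hrest, hm, .inr hbase⟩) hmin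
    · exact ⟨i, m, him, hi, by omega, i, m, him, by omega, by omega⟩
    · exact ⟨i, m, him, hi, by omega, m, i, him.symm, by omega, by omega⟩

theorem IsSplittable.pi_of_prod {M : ι → Type*} [∀ l, AddCommGroup (M l)] {i m : ι} (him : i ≠ m)
    (hM : ∀ l, l = i ∨ l = m ∨ Subsingleton (M l)) (h : IsSplittable (M i × M m)) :
    IsSplittable (∀ l, M l) := by
  classical
  refine h.of_addEquiv (AddEquiv.ofBijective
    ((Pi.evalAddMonoidHom M i).prod (Pi.evalAddMonoidHom M m)) ⟨fun x y hxy => ?_, ?_⟩).symm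
  · funext l
    rcases hM l with rfl | rfl | hl
    exacts [congrArg Prod.fst hxy, congrArg Prod.snd hxy, Subsingleton.elim _ _]
  · rintro ⟨a, b⟩
    exact ⟨Pi.single i a + Pi.single m b, by simp [him, him.symm]⟩

theorem IsSplittable.pi_of_prod_prod {M : ι → Type*} [∀ l, AddCommGroup (M l)] {i j m : ι}
    (hij : i ≠ j) (him : i ≠ m) (hjm : j ≠ m)
    (hM : ∀ l, l = i ∨ l = j ∨ l = m ∨ Subsingleton (M l)) (h : IsSplittable (M i × M j × M m)) :
    IsSplittable (∀ l, M l) := by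
  classical
  refine h.of_addEquiv (AddEquiv.ofBijective ((Pi.evalAddMonoidHom M i).prod
    ((Pi.evalAddMonoidHom M j).prod (Pi.evalAddMonoidHom M m))) ⟨fun x y hxy => ?_, ?_⟩).symm
  · funext l
    rcases hM l with rfl | rfl | rfl | hl
    exacts [congrArg Prod.fst hxy, congrArg (·.2.1) hxy, congrArg (·.2.2) hxy,
      Subsingleton.elim _ _]
  · rintro ⟨a, b, c⟩
    exact ⟨Pi.single i a + Pi.single j b + Pi.single m c,
      by simp [hij, hij.symm, him, him.symm, hjm, hjm.symm]⟩

theorem isSplittable_zmod_two_prod_two_pow {k : ℕ} (hk : 2 ≤ k) :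
    IsSplittable (ZMod 2 × ZMod (2 ^ k)) := by
  obtain ⟨q, rfl⟩ := Nat.exists_eq_add_of_le hk
  rw [pow_add]
  exact (isSplittable_zmod_four_mul_two (2 ^ q)).of_addEquiv AddEquiv.prodComm

theorem IsMinimalExponents.isSplittable {e : ι → ℕ} (he : IsMinimalExponents e) :
    IsSplittable (∀ l, ZMod (2 ^ e l)) := by
  have hsub (l) (hl : e l = 0) : Subsingleton (ZMod (2 ^ e l)) := by
    rw [hl, pow_zero]
    infer_instance
  obtain ⟨i, m, him, hrest, hm, hi | ⟨hi, hm⟩⟩ | ⟨i, j, m, hij, him, hjm, hrest, hi, hj, hm⟩ := he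
  · refine .pi_of_prod him (fun l => (hrest l).imp_right (.imp_right (hsub l))) ?_
    rw [hi]
    exact isSplittable_zmod_two_prod_two_pow hm
  · refine .pi_of_prod him (fun l => (hrest l).imp_right (.imp_right (hsub l))) ?_
    rw [hi, hm]
    exact isSplittable_zmod_four_four
  · refine .pi_of_prod_prod hij him hjm
      (fun l => (hrest l).imp_right (.imp_right (.imp_right (hsub l)))) ?_
    rw [hi, hj, hm]
    exact isSplittable_zmod_two_two_four

theorem IsAmpleExponents.isSplittable {e : ι → ℕ} [Finite ι] (he : IsAmpleExponents e) :
    IsSplittable (∀ l, ZMod (2 ^ e l)) := by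
  classical
  have := Fintype.ofFinite ι
  induction hs : ∑ l, e l using Nat.strong_induction_on generalizing e with
  | _ s ih =>
  by_cases hmin : IsMinimalExponents e
  · exact hmin.isSplittable
  obtain ⟨j, k, hjk, hj, hk, he'⟩ := he.exists_lowerPair hmin
  exact .pi_two_pow_of_lowerPair hjk hj hk (ih _ (hs ▸ sum_lowerPair_lt k hj) he' rfl)

end TwoGroup

section Ample

/-- A finite abelian group is ample if it has at least two involutions and is not an elementary
abelian `2`-group. This form of the group condition, unlike `CycleCondition`, passes to the
quotients met in the induction. -/
structure IsAmple (K : Type*) [AddCommGroup K] : Prop where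
  two_lt_ncard : 2 < {x : K | x + x = 0}.ncard
  exists_add_self_ne_zero : ∃ x : K, x + x ≠ 0

theorem IsAmple.of_injective {K L : Type*} [AddCommGroup K] [AddCommGroup L] [Finite L]
    (h : IsAmple K) {f : K →+ L} (hf : Function.Injective f) : IsAmple L where
  two_lt_ncard := h.two_lt_ncard.trans_le <| Set.ncard_le_ncard_of_injOn f
    (fun x (hx : x + x = 0) => show f x + f x = 0 by rw [← map_add, hx, map_zero]) hf.injOn
  exists_add_self_ne_zero :=
    have ⟨x, hx⟩ := h.exists_add_self_ne_zero
    ⟨f x, by rwa [← map_add, map_ne_zero_iff f hf]⟩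

theorem ncard_le_ncard_quotient {K : Type*} [AddCommGroup K] [Finite K] {N : AddSubgroup K}
    (hN : Odd (Nat.card N)) : {x : K | x + x = 0}.ncard ≤ {x : K ⧸ N | x + x = 0}.ncard :=
  Set.ncard_le_ncard_of_injOn (QuotientAddGroup.mk' N)
    (fun x (hx : x + x = 0) => show QuotientAddGroup.mk' N x + QuotientAddGroup.mk' N x = 0 by
      rw [← map_add, hx, map_zero]) (injOn_mk_of_odd_card hN)

theorem IsAmple.quotient {K : Type*} [AddCommGroup K] [Finite K] (h : IsAmple K)
    {N : AddSubgroup K} (hN : Odd (Nat.card N)) {x : K} (hx : x + x ∉ N) : IsAmple (K ⧸ N) where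
  two_lt_ncard := h.two_lt_ncard.trans_le (ncard_le_ncard_quotient hN)
  exists_add_self_ne_zero := ⟨x, fun hxx => hx ((QuotientAddGroup.eq_zero_iff _).1 hxx)⟩

theorem IsAmple.two_lt_card {K : Type*} [AddCommGroup K] [Finite K] (h : IsAmple K) :
    2 < Nat.card K :=
  h.two_lt_ncard.trans_le (Set.ncard_le_card _)

theorem exists_addEquiv_pi_zmod_two_pow {K : Type*} [AddCommGroup K] [Finite K] {k : ℕ}
    (hK : Nat.card K = 2 ^ k) :
    ∃ (ι : Type) (_ : Fintype ι) (e : ι → ℕ), Nonempty (K ≃+ ∀ l, ZMod (2 ^ e l)) := by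
  obtain ⟨ι, _, p, -, e, ⟨f⟩⟩ := AddCommGroup.equiv_directSum_zmod_of_finite K
  have g := f.trans (DirectSum.addEquivProd fun l => ZMod (p l ^ e l))
  have hdvd (l) : p l ^ e l ∣ 2 ^ k := by
    rw [← hK, Nat.card_congr g.toEquiv, Nat.card_pi]
    simpa only [Nat.card_zmod] using Finset.dvd_prod_of_mem (fun l => p l ^ e l) (Finset.mem_univ l)
  choose d hd using fun l => (Nat.dvd_prime_pow Nat.prime_two).1 (hdvd l)
  obtain ⟨-, hd⟩ := forall_and.1 hd
  exact ⟨ι, inferInstance, d,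
    ⟨g.trans (AddEquiv.piCongrRight fun l => (ZMod.ringEquivCongr (hd l)).toAddEquiv)⟩⟩

theorem ncard_add_self_eq_zero_le {A : Type*} [AddCommGroup A] [Finite A] [IsAddCyclic A] :
    {x : A | x + x = 0}.ncard ≤ 2 := by
  classical
  have := Fintype.ofFinite A
  rw [Set.ncard_eq_toFinset_card', Set.toFinset_ofPred]
  simpa only [two_nsmul] using IsAddCyclic.card_nsmul_eq_zero_le (α := A) two_pos

theorem IsAmple.isAmpleExponents {ι : Type*} {e : ι → ℕ} (h : IsAmple (∀ l, ZMod (2 ^ e l))) :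
    IsAmpleExponents e := by
  obtain ⟨m, hm⟩ : ∃ m, 2 ≤ e m := by
    by_contra! hlt
    obtain ⟨x, hx⟩ := h.exists_add_self_ne_zero
    refine hx (funext fun l => ?_)
    have hl : 2 ^ e l ∣ 2 ^ 1 := pow_dvd_pow 2 (Nat.le_of_lt_succ (hlt l))
    have htwo : ((2 : ℕ) : ZMod (2 ^ e l)) = 0 := (ZMod.natCast_eq_zero_iff _ _).2 hl
    change x l + x l = 0
    rw [← two_nsmul, nsmul_eq_mul, htwo, zero_mul]
  by_contra hnot
  have hsub (l) (hl : l ≠ m) : Subsingleton (ZMod (2 ^ e l)) := by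
    have : e l = 0 := by
      by_contra hne
      exact hnot ⟨l, m, hl, Nat.one_le_iff_ne_zero.2 hne, hm⟩
    rw [this, pow_zero]
    infer_instance
  refine h.two_lt_ncard.not_ge (le_trans ?_ (ncard_add_self_eq_zero_le (A := ZMod (2 ^ e m))))
  refine Set.ncard_le_ncard_of_injOn (· m) (fun x hx => congrFun hx m) fun x _ y _ hxy => ?_
  funext l
  by_cases hl : l = m
  · exact hl ▸ hxy
  · exact (hsub l hl).elim _ _

theorem IsAmple.isSplittable_of_card_eq_two_pow {K : Type*} [AddCommGroup K] [Finite K] {k : ℕ}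
    (h : IsAmple K) (hK : Nat.card K = 2 ^ k) : IsSplittable K := by
  obtain ⟨ι, _, e, ⟨f⟩⟩ := exists_addEquiv_pi_zmod_two_pow hK
  have : Finite (∀ l, ZMod (2 ^ e l)) := .of_equiv K f.toEquiv
  have he := (h.of_injective (f := f.toAddMonoidHom) f.injective).isAmpleExponents
  exact he.isSplittable.of_addEquiv f.symm

theorem IsSplittable.of_quotient_zmultiples {K : Type*} [AddCommGroup K] [Finite K] {g : K}
    (hodd : Odd (addOrderOf g)) (h : IsSplittable (K ⧸ AddSubgroup.zmultiples g)) :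
    IsSplittable K := by
  have hker := QuotientAddGroup.ker_mk' (AddSubgroup.zmultiples g)
  refine h.of_cyclic_odd_ker (QuotientAddGroup.mk'_surjective (AddSubgroup.zmultiples g)) ?_
    (g := ⟨g, hker.symm ▸ AddSubgroup.mem_zmultiples g⟩) ?_
  · rwa [hker, Nat.card_zmultiples]
  · rintro ⟨y, hy⟩
    rw [hker] at hy
    obtain ⟨k, rfl⟩ := AddSubgroup.mem_zmultiples_iff.1 hy
    exact AddSubgroup.mem_zmultiples_iff.2 ⟨k, rfl⟩

theorem IsAmple.isSplittable {K : Type*} [AddCommGroup K] [Finite K] (h : IsAmple K) :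
    IsSplittable K := by
  induction hs : Nat.card K using Nat.strong_induction_on generalizing K with
  | _ s ih =>
  by_cases hpow : ∀ p : ℕ, p.Prime → p ∣ Nat.card K → p = 2
  · exact h.isSplittable_of_card_eq_two_pow
      (Nat.eq_prime_pow_of_unique_prime_dvd Nat.card_pos.ne' fun {p} => hpow p)
  push Not at hpow
  obtain ⟨p, hp, hpK, hp₂⟩ := hpow
  have : Fact p.Prime := ⟨hp⟩
  obtain ⟨g, hg⟩ := exists_prime_addOrderOf_dvd_card' p hpK
  have hN : Nat.card (AddSubgroup.zmultiples g) = p := by rw [Nat.card_zmultiples, hg]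
  have hodd : Odd p := hp.odd_of_ne_two hp₂
  by_cases hdouble : ∀ x, x + x ∈ AddSubgroup.zmultiples g
  · exact isSplittable_of_add_self_mem hp₂ hN hdouble
      (h.two_lt_ncard.trans_le ((ncard_le_ncard_quotient (hN ▸ hodd)).trans (Set.ncard_le_card _)))
  push Not at hdouble
  obtain ⟨x, hx⟩ := hdouble
  have hlt : Nat.card (K ⧸ AddSubgroup.zmultiples g) < s := by
    rw [← hs, AddSubgroup.card_eq_card_quotient_mul_card_addSubgroup (AddSubgroup.zmultiples g), hN]
    exact lt_mul_of_one_lt_right Nat.card_pos hp.one_lt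
  exact .of_quotient_zmultiples (hg ▸ hodd) (ih _ hlt (h.quotient (hN ▸ hodd) hx) rfl)

theorem isAmple_zmod_two_prod_two_mul {s : ℕ} (hs : 2 ≤ s) : IsAmple (ZMod 2 × ZMod (2 * s)) := by
  have : NeZero (2 * s) := ⟨by omega⟩
  have hcast {k : ℕ} (hk : 0 < k) (hlt : k < 2 * s) : (k : ZMod (2 * s)) ≠ 0 := fun h =>
    (Nat.le_of_dvd hk ((ZMod.natCast_eq_zero_iff _ _).1 h)).not_gt hlt
  have hs₀ := hcast (k := s) (by omega) (by omega)
  have htwo := hcast (k := 2) (by omega) (by omega)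
  have hss : (s : ZMod (2 * s)) + s = 0 := by
    rw [← two_mul]
    exact_mod_cast ZMod.natCast_self (2 * s)
  constructor
  · rw [Set.two_lt_ncard_iff]
    refine ⟨(0, 0), (1, 0), (0, s), by simp, ?_, ?_, by simp, ?_, by simp⟩
    · exact Prod.ext rfl (add_zero 0)
    · exact Prod.ext rfl hss
    · simpa using hs₀.symm
  · exact ⟨(0, 1), fun h => htwo (by simpa [one_add_one_eq_two] using congrArg Prod.snd h)⟩

theorem isAmple_of_cycleCondition {n : ℕ} {K : Type*} [AddCommGroup K] [Finite K] (hn : Even n)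
    (h : CycleCondition n K) : IsAmple K := by
  obtain ⟨-, hodd | ⟨-, s, hs, S, ⟨e⟩⟩⟩ := h
  · exact absurd hodd (Nat.not_odd_iff_even.2 hn)
  · exact (isAmple_zmod_two_prod_two_mul hs).of_injective
      (f := S.subtype.comp e.symm.toAddMonoidHom) (S.subtype_injective.comp e.symm.injective)

end Ample

theorem mainTheorem6 {Γ : Type*} [AddCommGroup Γ] [Finite Γ] (n m : ℕ)
    (hn : Even n) (hm : Odd m) (hΓ : Nat.card Γ = m * n)
    (hH : ∃ H : AddSubgroup Γ, Nat.card H = m ∧ CycleCondition n (Γ ⧸ H)) :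
    IsHarmonious (dutchWindmill n m) Γ := by
  obtain ⟨H, hHm, hK⟩ := hH
  have hample : IsAmple (Γ ⧸ H) := isAmple_of_cycleCondition hn hK
  obtain ⟨θ, hθ, hcycle⟩ := hample.isSplittable.exists_oneCycle
  exact isHarmonious_dutchWindmill_of_quotient (hK.1 ▸ hample.two_lt_card) hm hHm hK.1 hθ hcycle
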